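/- All graphs are finite and simple. A dissociation set of a graph $G$ is a set $S\subseteq V(G)$ (possibly empty) such that every vertex of the subgraph induced by $S$ has degree at most one in that subgraph; $d(G)$ denotes the number of dissociation sets of $G$. For $r\ge 1$ and $H=K_{s_1}\cup\dots\cup K_{s_t}$ a disjoint union of complete graphs, $K_r*H$ denotes the graph obtained from the disjoint union of $K_r$ and $H$ by choosing a vertex $u$ of $K_r$ and joining $u$ to exactly one vertex of each component of $H$. For $n\ge 9$ put $$F_n=\begin{cases}K_1*\frac{n-1}{2}K_2& n\text{ odd},\\ K_2*\frac{n-2}{2}K_2& n\text{ even},\end{cases}\qquad T_n=\begin{cases}K_1*\left(2K_1\cup\frac{n-3}{2}K_2\right)& n\text{ odd},\\ K_1*\left(3K_1\cup\frac{n-4}{2}K_2\right)& n\text{ even},\end{cases}$$ $$U_n=\begin{cases}K_3*\frac{n-3}{2}K_2& n\text{ odd},\\ K_3*\left(\frac{n-4}{2}K_2\cup K_1\right)& n\text{ even},\end{cases}\qquad h(n)=\begin{cases}2^{n-1}+(n+9)\,2^{(n-7)/2}& n\text{ odd},\\ 2^{n-1}+(n+12)\,2^{(n-8)/2}& n\text{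 even}.\end{cases}$$ **Theorem.** Let $n\ge 9$. Then $h(n)<d(F_n)$, and every connected graph $G$ of order $n$ with $G\not\cong F_n$ satisfies $d(G)\le h(n)$, with equality if and only if $G\cong U_n$ or $G\cong T_n$. (Hence $h(n)$ is the second-largest number of dissociation sets among connected graphs of order $n$.) -/

import Mathlib

/-- `S` is a dissociation set of `G`: every vertex of the subgraph induced by `S` has degree
at most one in that subgraph. -/
def IsDissociationSet {V : Type*} (G : SimpleGraph V) (S : Set V) : Prop :=
  ∀ v : S, ((G.induce S).neighborSet v).encard ≤ 1

/-- `d(G)`: the number of all dissociation sets of `G` (the empty set is one of them).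
Intended for graphs on a finite vertex set. -/
noncomputable def numDissociationSets {V : Type*} (G : SimpleGraph V) : ℕ :=
  {S : Set V | IsDissociationSet G S}.ncard

/-- `K_r * (⋃ i, K_{s i})`: the disjoint union of the complete graphs `K_r` (the vertices `inl a`)
and `K_{s i}` (the vertices `inr ⟨i, x⟩`), in which one vertex of `K_r`, namely number `0`, is joined
to exactly one vertex of each `K_{s i}`, namely number `0`. Intended for `1 ≤ r` and `1 ≤ s i`.
By the symmetry of complete graphs, other choices of these vertices give an isomorphic graph. -/
def cliqueJoin (r : ℕ) {ι : Type*} (s : ι → ℕ) : SimpleGraph (Fin r ⊕ (Σ i : ι, Fin (s i))) where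
  Adj
    | .inl a, .inl b => a ≠ b
    | .inl a, .inr q => a.val = 0 ∧ q.2.val = 0
    | .inr p, .inl b => p.2.val = 0 ∧ b.val = 0
    | .inr p, .inr q => p.1 = q.1 ∧ p ≠ q
  symm := ⟨by
    rintro (a | p) (b | q) h
    · exact Ne.symm h
    · exact ⟨h.2, h.1⟩
    · exact ⟨h.2, h.1⟩
    · exact ⟨h.1.symm, h.2.symm⟩⟩
  loopless := ⟨by
    rintro (a | p) h
    · exact h rfl
    · exact h.2 rfl⟩

/-- The sizes of the components of `a K_1 ∪ b K_2`. -/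
def sizesOneTwo (a b : ℕ) : Fin a ⊕ Fin b → ℕ :=
  Sum.elim (fun _ => 1) (fun _ => 2)

/-- The vertex set of `K_r * (a K_1 ∪ b K_2)`. -/
abbrev JoinOneTwoVert (r a b : ℕ) : Type :=
  Fin r ⊕ (Σ i : Fin a ⊕ Fin b, Fin (sizesOneTwo a b i))

/-- The graph `K_r * (a K_1 ∪ b K_2)`. -/
abbrev joinOneTwo (r a b : ℕ) : SimpleGraph (JoinOneTwoVert r a b) :=
  cliqueJoin r (sizesOneTwo a b)

/-- The graph `F_n` for `n ≥ 7`: `K_1 * ((n-1)/2) K_2` for odd `n` and `K_2 * ((n-2)/2) K_2`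
for even `n`. -/
def graphF (n : ℕ) :
    SimpleGraph (JoinOneTwoVert (if Odd n then 1 else 2) 0
      (if Odd n then (n - 1) / 2 else (n - 2) / 2)) :=
  joinOneTwo _ _ _

/-- The graph `U_n` for `n ≥ 7`: `K_3 * (⌊(n-3)/2⌋ K_2 ∪ ((n+1) mod 2) K_1)`. -/
def graphU (n : ℕ) : SimpleGraph (JoinOneTwoVert 3 ((n + 1) % 2) ((n - 3) / 2)) :=
  joinOneTwo _ _ _

/-- The graph `T_n` for `n ≥ 9`: `K_1 * (2 K_1 ∪ ((n-3)/2) K_2)` for odd `n` and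
`K_1 * (3 K_1 ∪ ((n-4)/2) K_2)` for even `n`. -/
def graphT (n : ℕ) :
    SimpleGraph (JoinOneTwoVert 1 (if Odd n then 2 else 3)
      (if Odd n then (n - 3) / 2 else (n - 4) / 2)) :=
  joinOneTwo _ _ _

/-- The number `h(n)` for `n ≥ 8` (there all subtractions and divisions are exact):
`2^(n-1) + (n+9) 2^((n-7)/2)` for odd `n` and `2^(n-1) + (n+12) 2^((n-8)/2)` for even `n`. -/
def secondBound (n : ℕ) : ℕ :=
  if Odd n then 2 ^ (n - 1) + (n + 9) * 2 ^ ((n - 7) / 2)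
  else 2 ^ (n - 1) + (n + 12) * 2 ^ ((n - 8) / 2)

/-! A graph `G` of order `n` has at most `2 ^ (n - k) * d(T)` dissociation sets if a tree `T` of
order `k` embeds into it, since a dissociation set of `G` leaves a dissociation set on `T`. The
proof distinguishes whether `G` contains two disjoint paths on three vertices.

If it does, such paths can be moved until an edge joins them (`exists_adj_cherries`), so `G`
contains one of three trees of order six. These trees are grown inside `G` by adding leaves,
until the density `d(T) / 2 ^ k` of dissociation sets drops to `1 / 2` or `T` spans `G`. The
density falls to `1 / 2` at order eleven at the latest, and the trees of orders nine and ten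
that occur on the way have fewer than `secondBound` dissociation sets. This is a finite search
(`treeSearch`), which is evaluated in the kernel; `lt_secondBound_of_treeSearch` draws the
conclusion that `d(G) < secondBound n`, using `2 ^ (n - 1) < secondBound n`.

If it does not, then since `n ≥ 9` there is a vertex `v`, the hub, such that `G - v` has maximum
degree at most one (`exists_isHub_of_no_disjoint_cherries`); a vertex of maximum degree will do.
With `b` the number of vertices not adjacent to `v`, sorting the dissociation sets by their
trace on the closed neighbourhood of `v` gives `2 d(G) = 2 ^ n + 2 ^ b (2 n - 3 b)`, whatever
`G` is otherwise. The right hand side is strictly increasing in `b ≤ (n - 1) / 2`. The maximal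
`b` gives `F_n` only; the next one leaves two or three neighbours of `v` without far neighbours,
and among these there is no edge (`T_n`) or one edge (`U_n`). -/

/-! ### Dissociation sets as finsets -/

theorem isDissociationSet_iff {V : Type*} (G : SimpleGraph V) (S : Set V) :
    IsDissociationSet G S ↔
      ∀ x ∈ S, ∀ y ∈ S, ∀ z ∈ S, G.Adj x y → G.Adj x z → y = z := by
  simp only [IsDissociationSet, Set.encard_le_one_iff, Subtype.forall, SimpleGraph.mem_neighborSet,
    SimpleGraph.comap_adj, Function.Embedding.subtype_apply, Subtype.mk.injEq]

open Classical in
/-- The dissociation sets of a finite graph as a finset of finsets. -/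
noncomputable def dissociationFinset {V : Type*} [Fintype V] (G : SimpleGraph V) :
    Finset (Finset V) :=
  {S | ∀ x ∈ S, ∀ y ∈ S, ∀ z ∈ S, G.Adj x y → G.Adj x z → y = z}

theorem mem_dissociationFinset {V : Type*} [Fintype V] {G : SimpleGraph V} {S : Finset V} :
    S ∈ dissociationFinset G ↔
      ∀ x ∈ S, ∀ y ∈ S, ∀ z ∈ S, G.Adj x y → G.Adj x z → y = z := by
  simp [dissociationFinset]

theorem numDissociationSets_eq_card {V : Type*} [Fintype V] (G : SimpleGraph V) :
    numDissociationSets G = (dissociationFinset G).card := by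
  classical
  rw [numDissociationSets, ← Set.ncard_coe_finset]
  symm
  refine Set.ncard_congr (fun S _ => (S : Set V)) ?_ ?_ ?_
  · intro S hS
    rw [Set.mem_ofPred_eq, isDissociationSet_iff]
    simpa [mem_dissociationFinset] using hS
  · intro S T _ _ h
    exact Finset.coe_injective h
  · intro S hS
    refine ⟨S.toFinset, ?_, by simp⟩
    rw [Set.mem_ofPred_eq, isDissociationSet_iff] at hS
    simpa [mem_dissociationFinset] using hS

theorem numDissociationSets_congr {V W : Type*} {G : SimpleGraph V} {H : SimpleGraph W}
    (e : G ≃g H) : numDissociationSets G = numDissociationSets H := by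
  refine Set.ncard_congr (fun S _ => e '' S) ?_ ?_ ?_
  · intro S hS
    simp only [Set.mem_ofPred_eq, isDissociationSet_iff] at hS ⊢
    rintro _ ⟨x, hx, rfl⟩ _ ⟨y, hy, rfl⟩ _ ⟨z, hz, rfl⟩ h₁ h₂
    rw [hS x hx y hy z hz (e.map_rel_iff.1 h₁) (e.map_rel_iff.1 h₂)]
  · intro S T _ _ h
    exact e.injective.image_injective h
  · intro T hT
    refine ⟨e ⁻¹' T, ?_, Set.image_preimage_eq T e.surjective⟩
    simp only [Set.mem_ofPred_eq, isDissociationSet_iff] at hT ⊢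
    intro x hx y hy z hz h₁ h₂
    exact e.injective (hT _ hx _ hy _ hz (e.map_rel_iff.2 h₁) (e.map_rel_iff.2 h₂))

/-! ### Graphs with a hub -/

/-- `v` is a hub of `G`: the graph `G - v` has maximum degree at most one, and every vertex
that is not adjacent to `v` has a neighbour adjacent to `v`. For connected `G` the second condition
follows from the first. -/
structure IsHub {V : Type*} (G : SimpleGraph V) (v : V) : Prop where
  eq_of_adj : ∀ x y z, x ≠ v → y ≠ v → z ≠ v → G.Adj x y → G.Adj x z → y = z
  exists_near : ∀ w, w ≠ v → ¬ G.Adj v w → ∃ u, G.Adj v u ∧ G.Adj w u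

open Classical in
/-- The vertices other than `v` that are not adjacent to `v`. -/
noncomputable def farVertices {V : Type*} [Fintype V] (G : SimpleGraph V) (v : V) : Finset V :=
  {w | w ≠ v ∧ ¬ G.Adj v w}

open Classical in
/-- The neighbours of `v`. -/
noncomputable def nearVertices {V : Type*} [Fintype V] (G : SimpleGraph V) (v : V) : Finset V :=
  {u | G.Adj v u}

section Hub

variable {V : Type*} [Fintype V] {G : SimpleGraph V} {v : V}

@[simp] theorem mem_farVertices {w : V} : w ∈ farVertices G v ↔ w ≠ v ∧ ¬ G.Adj v w := by
  simp [farVertices]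

@[simp] theorem mem_nearVertices {w : V} : w ∈ nearVertices G v ↔ G.Adj v w := by
  simp [nearVertices]

theorem card_near_add_card_far :
    (nearVertices G v).card + (farVertices G v).card + 1 = Fintype.card V := by
  classical
  have h : Disjoint (nearVertices G v) (farVertices G v) := by
    rw [Finset.disjoint_left]
    intro x hx hx'
    simp_all
  rw [← Finset.card_union_of_disjoint h, ← Finset.card_univ,
    ← Finset.card_erase_add_one (Finset.mem_univ v)]
  congr 2
  ext x
  have := G.ne_of_adj (a := v) (b := x)
  simp only [Finset.mem_union, mem_nearVertices, mem_farVertices, Finset.mem_erase,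
    Finset.mem_univ, and_true]
  grind

theorem IsHub.not_adj_of_far (hv : IsHub G v) {w x : V} (hw : w ∈ farVertices G v)
    (hx : x ∈ farVertices G v) : ¬ G.Adj w x := by
  intro h
  rw [mem_farVertices] at hw hx
  obtain ⟨u, hu, hwu⟩ := hv.exists_near w hw.1 hw.2
  exact hx.2 (hv.eq_of_adj w x u hw.1 hx.1 hu.ne' h hwu ▸ hu)

open Classical in
/-- The partner of a far vertex identifies the far vertices with the near vertices that have a far
neighbour. -/
theorem IsHub.card_near_with_far (hv : IsHub G v) :
    ((nearVertices G v).filter fun u => ∃ w ∈ farVertices G v, G.Adj u w).card =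
      (farVertices G v).card := by
  symm
  choose! f hf using hv.exists_near
  refine Finset.card_bij (fun w _ => f w) ?_ ?_ ?_
  · intro w hw
    have hw' := mem_farVertices.1 hw
    have := hf w hw'.1 hw'.2
    rw [Finset.mem_filter, mem_nearVertices]
    exact ⟨this.1, w, hw, this.2.symm⟩
  · intro w hw x hx h
    have hw' := mem_farVertices.1 hw
    have hx' := mem_farVertices.1 hx
    have h₁ := hf w hw'.1 hw'.2
    have h₂ := hf x hx'.1 hx'.2
    refine hv.eq_of_adj (f w) w x h₁.1.ne' hw'.1 hx'.1 h₁.2.symm ?_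
    have h : f w = f x := h
    rw [h]
    exact h₂.2.symm
  · intro u hu
    rw [Finset.mem_filter, mem_nearVertices] at hu
    obtain ⟨hu, w, hw, huw⟩ := hu
    have hw' := mem_farVertices.1 hw
    have h₁ := hf w hw'.1 hw'.2
    exact ⟨w, hw, hv.eq_of_adj w (f w) u hw'.1 h₁.1.ne' hu.ne' h₁.2 huw.symm⟩

open Classical in
theorem IsHub.card_not_mem (hv : IsHub G v) :
    ((dissociationFinset G).filter fun S => v ∉ S).card = 2 ^ (Fintype.card V - 1) := by
  rw [← Finset.card_univ, ← Finset.card_erase_of_mem (Finset.mem_univ v), ← Finset.card_powerset]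
  congr 1
  ext S
  rw [Finset.mem_filter, mem_dissociationFinset, Finset.mem_powerset]
  constructor
  · intro h x hx
    exact Finset.mem_erase.2 ⟨fun hxv => h.2 (hxv ▸ hx), Finset.mem_univ x⟩
  · intro h
    have hne : ∀ x ∈ S, x ≠ v := fun x hx => (Finset.mem_erase.1 (h hx)).1
    exact ⟨fun x hx y hy z hz => hv.eq_of_adj x y z (hne x hx) (hne y hy) (hne z hz),
      fun hvS => hne v hvS rfl⟩

open Classical in
theorem IsHub.card_mem_isolated (hv : IsHub G v) :
    ((dissociationFinset G).filter fun S => v ∈ S ∧ ∀ u ∈ S, ¬ G.Adj v u).card =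
      2 ^ (farVertices G v).card := by
  rw [← Finset.card_powerset]
  refine Finset.card_nbij' (fun S => S.erase v) (fun T => insert v T) ?_ ?_ ?_ ?_
  · intro S hS
    simp only [Finset.coe_filter, Set.mem_ofPred_eq] at hS
    simp only [Finset.coe_powerset, Set.mem_preimage, Set.mem_powerset_iff, Finset.coe_subset]
    intro x hx
    rw [Finset.mem_erase] at hx
    exact mem_farVertices.2 ⟨hx.1, hS.2.2 x hx.2⟩
  · intro T hT
    simp only [Finset.coe_powerset, Set.mem_preimage, Set.mem_powerset_iff,
      Finset.coe_subset] at hT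
    simp only [Finset.coe_filter, Set.mem_ofPred_eq, mem_dissociationFinset]
    have hnv : ∀ u ∈ insert v T, ¬ G.Adj v u := by
      intro u hu
      rcases Finset.mem_insert.1 hu with rfl | hu
      · exact G.loopless.irrefl _
      · exact (mem_farVertices.1 (hT hu)).2
    refine ⟨?_, Finset.mem_insert_self _ _, hnv⟩
    intro x hx y hy z hz h₁ h₂
    exfalso
    rcases Finset.mem_insert.1 hx with rfl | hxT
    · exact hnv y hy h₁
    · rcases Finset.mem_insert.1 hy with rfl | hyT
      · exact hnv x hx h₁.symm
      · exact hv.not_adj_of_far (hT hxT) (hT hyT) h₁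
  · intro S hS
    simp only [Finset.coe_filter, Set.mem_ofPred_eq] at hS
    exact Finset.insert_erase hS.2.1
  · intro T hT
    simp only [Finset.coe_powerset, Set.mem_preimage, Set.mem_powerset_iff,
      Finset.coe_subset] at hT
    exact Finset.erase_insert fun h => (mem_farVertices.1 (hT h)).1 rfl

open Classical in
theorem IsHub.card_mem_paired (hv : IsHub G v) {u : V} (hu : G.Adj v u) :
    ((dissociationFinset G).filter fun S => v ∈ S ∧ u ∈ S).card =
      2 ^ ((farVertices G v).filter fun w => ¬ G.Adj u w).card := by
  rw [← Finset.card_powerset]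
  refine Finset.card_nbij' (fun S => (S.erase v).erase u) (fun T => insert v (insert u T))
    ?_ ?_ ?_ ?_
  · intro S hS
    simp only [Finset.coe_filter, Set.mem_ofPred_eq, mem_dissociationFinset] at hS
    simp only [Finset.coe_powerset, Set.mem_preimage, Set.mem_powerset_iff, Finset.coe_subset]
    intro x hx
    rw [Finset.mem_erase, Finset.mem_erase] at hx
    obtain ⟨hS, hvS, huS⟩ := hS
    rw [Finset.mem_filter, mem_farVertices]
    exact ⟨⟨hx.2.1, fun h => hx.1 (hS v hvS x hx.2.2 u huS h hu)⟩,
      fun h => hx.2.1 (hS u huS x hx.2.2 v hvS h hu.symm)⟩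
  · intro T hT
    simp only [Finset.coe_powerset, Set.mem_preimage, Set.mem_powerset_iff,
      Finset.coe_subset] at hT
    simp only [Finset.coe_filter, Set.mem_ofPred_eq, mem_dissociationFinset]
    have hT₁ : ∀ x ∈ T, x ∈ farVertices G v := fun x hx => (Finset.mem_filter.1 (hT hx)).1
    have hT₂ : ∀ x ∈ T, ¬ G.Adj v x := fun x hx => (mem_farVertices.1 (hT₁ x hx)).2
    have hT₃ : ∀ x ∈ T, ¬ G.Adj u x := fun x hx => (Finset.mem_filter.1 (hT hx)).2
    have hT₄ : ∀ x ∈ T, ∀ y ∈ T, ¬ G.Adj x y :=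
      fun x hx y hy => hv.not_adj_of_far (hT₁ x hx) (hT₁ y hy)
    refine ⟨?_, by simp, by simp⟩
    intro x hx y hy z hz h₁ h₂
    have := G.loopless.irrefl v
    have := G.loopless.irrefl u
    simp only [Finset.mem_insert] at hx hy hz
    have hs : ∀ a b, G.Adj a b → G.Adj b a := fun a b h => h.symm
    grind
  · intro S hS
    simp only [Finset.coe_filter, Set.mem_ofPred_eq] at hS
    have := hu.ne
    ext x
    simp only [Finset.mem_insert, Finset.mem_erase]
    grind
  · intro T hT
    simp only [Finset.coe_powerset, Set.mem_preimage, Set.mem_powerset_iff,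
      Finset.coe_subset] at hT
    have h₁ : v ∉ T := fun h => (mem_farVertices.1 (Finset.mem_filter.1 (hT h)).1).1 rfl
    have h₂ : u ∉ T := fun h => (mem_farVertices.1 (Finset.mem_filter.1 (hT h)).1).2 hu
    have := hu.ne
    ext x
    simp only [Finset.mem_insert, Finset.mem_erase]
    grind

open Classical in
/-- A near vertex has at most one far neighbour. -/
theorem IsHub.two_pow_card_paired (hv : IsHub G v) {u : V} (hu : G.Adj v u) :
    2 * 2 ^ ((farVertices G v).filter fun w => ¬ G.Adj u w).card +
      (if ∃ w ∈ farVertices G v, G.Adj u w then 2 ^ (farVertices G v).card else 0) =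
      2 * 2 ^ (farVertices G v).card := by
  split_ifs with h
  · obtain ⟨w, hw, huw⟩ := h
    have : (farVertices G v).filter (fun w => ¬ G.Adj u w) = (farVertices G v).erase w := by
      ext x
      rw [Finset.mem_filter, Finset.mem_erase, and_comm]
      refine and_congr_left fun hx => ?_
      constructor
      · rintro h rfl
        exact h huw
      · intro h hux
        exact h (hv.eq_of_adj u x w hu.ne' (mem_farVertices.1 hx).1 (mem_farVertices.1 hw).1
          hux huw)
    rw [this, ← pow_succ', Finset.card_erase_add_one hw, two_mul]
  · push Not at h
    rw [Finset.filter_true_of_mem h, add_zero]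

/-- The number of dissociation sets of a graph with a hub depends only on the numbers of vertices
and of far vertices. -/
theorem IsHub.numDissociationSets_eq (hv : IsHub G v) :
    2 * numDissociationSets G +
        3 * (farVertices G v).card * 2 ^ (farVertices G v).card =
      2 ^ Fintype.card V + 2 * Fintype.card V * 2 ^ (farVertices G v).card := by
  classical
  have h₁ := Finset.card_filter_add_card_filter_not (s := dissociationFinset G) (fun S => v ∉ S)
  have h₂ := Finset.card_filter_add_card_filter_not
    (s := (dissociationFinset G).filter fun S => ¬ v ∉ S) (fun S => ∀ u ∈ S, ¬ G.Adj v u)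
  rw [Finset.filter_filter, Finset.filter_filter] at h₂
  simp only [not_not] at h₁ h₂
  rw [hv.card_mem_isolated] at h₂
  rw [hv.card_not_mem] at h₁
  have h₃ : (dissociationFinset G).filter (fun S => v ∈ S ∧ ¬ ∀ u ∈ S, ¬ G.Adj v u) =
      (nearVertices G v).biUnion
        fun u => (dissociationFinset G).filter fun S => v ∈ S ∧ u ∈ S := by
    ext S
    simp only [Finset.mem_filter, Finset.mem_biUnion, mem_nearVertices]
    push Not
    grind
  have h₄ : ((dissociationFinset G).filter (fun S => v ∈ S ∧ ¬ ∀ u ∈ S, ¬ G.Adj v u)).card =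
      ∑ u ∈ nearVertices G v, 2 ^ ((farVertices G v).filter fun w => ¬ G.Adj u w).card := by
    rw [h₃, Finset.card_biUnion]
    · exact Finset.sum_congr rfl fun u hu => hv.card_mem_paired (mem_nearVertices.1 hu)
    · intro x hx y hy hxy
      rw [Function.onFun, Finset.disjoint_left]
      intro S hS hS'
      rw [Finset.mem_filter, mem_dissociationFinset] at hS hS'
      exact hxy (hS.1 v hS.2.1 x hS.2.2 y hS'.2.2 (mem_nearVertices.1 hx) (mem_nearVertices.1 hy))
  have h₅ : 2 * ∑ u ∈ nearVertices G v, 2 ^ ((farVertices G v).filter fun w => ¬ G.Adj u w).card +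
      (farVertices G v).card * 2 ^ (farVertices G v).card =
      (nearVertices G v).card * (2 * 2 ^ (farVertices G v).card) := by
    conv_lhs => enter [2, 1]; rw [← hv.card_near_with_far]
    rw [Finset.mul_sum, ← smul_eq_mul (Finset.card _), ← Finset.sum_const,
      Finset.sum_filter, ← Finset.sum_add_distrib]
    rw [Finset.sum_congr rfl fun u hu => hv.two_pow_card_paired (mem_nearVertices.1 hu)]
    simp
  rw [numDissociationSets_eq_card]
  have h₆ : 2 * 2 ^ (Fintype.card V - 1) = 2 ^ Fintype.card V := by
    rw [← pow_succ', ← card_near_add_card_far (G := G) (v := v)]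
    simp
  have h₇ := card_near_add_card_far (G := G) (v := v)
  have h₈ : Fintype.card V * 2 ^ (farVertices G v).card =
      ((nearVertices G v).card + (farVertices G v).card + 1) * 2 ^ (farVertices G v).card := by
    rw [h₇]
  rw [h₄] at h₂
  rw [← h₆, ← h₁, ← h₂]
  linarith

end Hub

/-! ### The graphs `K_r * (a K_1 ∪ b K_2)` -/

theorem card_joinOneTwoVert (r a b : ℕ) :
    Fintype.card (JoinOneTwoVert r a b) = r + a + 2 * b := by
  have h₁ : ∀ i : Fin a, sizesOneTwo a b (.inl i) = 1 := fun _ => rfl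
  have h₂ : ∀ i : Fin b, sizesOneTwo a b (.inr i) = 2 := fun _ => rfl
  simp [JoinOneTwoVert, h₁, h₂, mul_comm b 2, add_assoc]

theorem cliqueJoin_adj_inr {r : ℕ} {ι : Type*} {s : ι → ℕ} {i j : ι} {x : Fin (s i)}
    {y : Fin (s j)} :
    (cliqueJoin r s).Adj (.inr ⟨i, x⟩) (.inr ⟨j, y⟩) ↔ i = j ∧ x.val ≠ y.val := by
  refine and_congr_right ?_
  rintro (rfl : i = j)
  simp [Fin.ext_iff]

theorem sigma_fin_ext_iff {ι : Type*} {s : ι → ℕ} {i j : ι} {x : Fin (s i)} {y : Fin (s j)} :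
    (⟨i, x⟩ : Σ i, Fin (s i)) = ⟨j, y⟩ ↔ i = j ∧ x.val = y.val := by
  constructor
  · intro h
    cases h
    exact ⟨rfl, rfl⟩
  · rintro ⟨rfl, h⟩
    rw [Fin.ext h]

theorem joinOneTwo_isHub {r a b : ℕ} (hr : 1 ≤ r) (hr' : r ≤ 3) :
    IsHub (joinOneTwo r a b) (.inl ⟨0, hr⟩) where
  eq_of_adj := by
    rintro (x | ⟨x, i⟩) (y | ⟨y, j⟩) (z | ⟨z, k⟩) hx hy hz h₁ h₂
    · have h₁ : x ≠ y := h₁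
      have h₂ : x ≠ z := h₂
      simp only [ne_eq, Sum.inl.injEq, Fin.ext_iff] at hx hy hz h₁ h₂ ⊢
      omega
    · exact absurd (congrArg Sum.inl (Fin.ext h₂.1)) hx
    · exact absurd (congrArg Sum.inl (Fin.ext h₁.1)) hx
    · exact absurd (congrArg Sum.inl (Fin.ext h₁.1)) hx
    · exact absurd (congrArg Sum.inl (Fin.ext h₁.2)) hy
    · exact absurd (congrArg Sum.inl (Fin.ext h₁.2)) hy
    · exact absurd (congrArg Sum.inl (Fin.ext h₂.2)) hz
    · rw [cliqueJoin_adj_inr] at h₁ h₂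
      obtain ⟨rfl, h₁⟩ := h₁
      obtain ⟨rfl, h₂⟩ := h₂
      have hs : sizesOneTwo a b x ≤ 2 := by
        rcases x with x | x
        · exact one_le_two
        · exact le_rfl
      have := i.2
      have := j.2
      have := k.2
      rw [Sum.inr.injEq, sigma_fin_ext_iff]
      exact ⟨rfl, by omega⟩
  exists_near := by
    rintro (x | ⟨x | x, i⟩) hx h
    · exact absurd (fun h => hx (by rw [h])) h
    · exact absurd ⟨rfl, Nat.lt_one_iff.1 i.2⟩ h
    · exact ⟨.inr ⟨.inr x, ⟨0, Nat.two_pos⟩⟩, ⟨rfl, rfl⟩,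
        cliqueJoin_adj_inr.2 ⟨rfl, fun h' => h ⟨rfl, h'⟩⟩⟩

theorem card_farVertices_joinOneTwo {r a b : ℕ} (hr : 1 ≤ r) :
    (farVertices (joinOneTwo r a b) (.inl ⟨0, hr⟩)).card = b := by
  symm
  refine (Finset.card_fin b).symm.trans (Finset.card_bij
    (fun (i : Fin b) _ => (.inr ⟨.inr i, ⟨1, Nat.one_lt_two⟩⟩ : JoinOneTwoVert r a b))
    ?_ ?_ ?_)
  · intro i _
    rw [mem_farVertices]
    exact ⟨Sum.inr_ne_inl, fun h => one_ne_zero h.2⟩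
  · intro i _ j _ h
    exact Sum.inr.inj (sigma_fin_ext_iff.1 (Sum.inr.inj h)).1
  · rintro (x | ⟨x | x, i⟩) hx <;> rw [mem_farVertices] at hx
    · exact absurd (fun h => hx.1 (by rw [h])) hx.2
    · exact absurd ⟨rfl, Nat.lt_one_iff.1 i.2⟩ hx.2
    · refine ⟨x, Finset.mem_univ _, ?_⟩
      have hi : i.val < 2 := i.2
      have hi' : i.val ≠ 0 := fun h => hx.2 ⟨rfl, h⟩
      have hi₁ : 1 = i.val := by omega
      exact congrArg Sum.inr (sigma_fin_ext_iff.2 ⟨rfl, hi₁⟩)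

section

variable {V : Type*} [Fintype V] {G : SimpleGraph V} {v : V}

/-- A graph with a hub `v` is of the form `K_r * (a K_1 ∪ b K_2)` as soon as the near vertices that
have a near neighbour lie in a clique `C` (of order `r - 1`) that has no edges to the rest of
`G - v`. -/
theorem IsHub.nonempty_iso_joinOneTwo (hv : IsHub G v) {r a b : ℕ} (C : Finset V)
    (hC : ∀ u ∈ C, G.Adj v u) (hCC : ∀ u ∈ C, ∀ w, w ≠ v → w ≠ u → (G.Adj u w ↔ w ∈ C))
    (hR : ∀ u ∉ C, G.Adj v u → ∀ w ∉ farVertices G v, w ≠ v → ¬ G.Adj u w)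
    (hr : r = C.card + 1) (hb : b = (farVertices G v).card)
    (hn : Fintype.card V = r + a + 2 * b) :
    Nonempty (G ≃g joinOneTwo r a b) := by
  classical
  subst hr
  have hpart := hv.card_near_with_far
  have hcard := card_near_add_card_far (G := G) (v := v)
  have hf := hv.exists_near
  choose! f hf using hf
  set N := (nearVertices G v).filter fun u => ∃ w ∈ farVertices G v, G.Adj u w with hN
  set R := (nearVertices G v \ C) \ N with hRdef
  have hCN : Disjoint C N := by
    rw [Finset.disjoint_left]
    intro x hx hx'
    obtain ⟨w, hw, hxw⟩ := (Finset.mem_filter.1 hx').2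
    rw [mem_farVertices] at hw
    exact hw.2 (hC w ((hCC x hx w hw.1 hxw.ne').1 hxw))
  have hCsub : C ⊆ nearVertices G v := fun x hx => mem_nearVertices.2 (hC x hx)
  have hNsub : N ⊆ nearVertices G v \ C := fun x hx =>
    Finset.mem_sdiff.2 ⟨(Finset.mem_filter.1 hx).1, fun h => Finset.disjoint_left.1 hCN h hx⟩
  have hRcard : R.card = a := by
    rw [hRdef, Finset.card_sdiff_of_subset hNsub, Finset.card_sdiff_of_subset hCsub]
    omega
  have eC : Fin C.card ≃ C := C.equivFin.symm
  have eR : Fin a ≃ R := (R.equivFinOfCardEq hRcard).symm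
  have eB : Fin b ≃ farVertices G v := ((farVertices G v).equivFinOfCardEq hb.symm).symm
  have hB₁ : ∀ i, (eB i : V) ≠ v ∧ ¬ G.Adj v (eB i) := fun i => mem_farVertices.1 (eB i).2
  have hB₂ : ∀ i, G.Adj v (f (eB i)) ∧ G.Adj (eB i) (f (eB i)) :=
    fun i => hf _ (hB₁ i).1 (hB₁ i).2
  have hC₁ : ∀ i, G.Adj v (eC i) := fun i => hC _ (eC i).2
  have hR₁ : ∀ i, G.Adj v (eR i) ∧ (eR i : V) ∉ C ∧ (eR i : V) ∉ N := fun i => by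
    obtain ⟨h₁, h₂⟩ := Finset.mem_sdiff.1 (eR i).2
    obtain ⟨h₁, h₃⟩ := Finset.mem_sdiff.1 h₁
    exact ⟨mem_nearVertices.1 h₁, h₃, h₂⟩
  have hR₂ : ∀ i, ∀ w, w ≠ v → ¬ G.Adj (eR i) w := fun i w hw h => by
    by_cases hwB : w ∈ farVertices G v
    · exact (hR₁ i).2.2 (Finset.mem_filter.2 ⟨mem_nearVertices.2 (hR₁ i).1, w, hwB, h⟩)
    · exact hR _ (hR₁ i).2.1 (hR₁ i).1 w hwB hw h
  have hN₁ : ∀ i, f (eB i) ∈ N := fun i =>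
    Finset.mem_filter.2 ⟨mem_nearVertices.2 (hB₂ i).1, _, (eB i).2, (hB₂ i).2.symm⟩
  have hNC : ∀ i, f (eB i) ∉ C := fun i h => Finset.disjoint_left.1 hCN h (hN₁ i)
  have hBC : ∀ i, (eB i : V) ∉ C := fun i h => (hB₁ i).2 (hC _ h)
  -- the unique neighbour of a far vertex, and the unique far neighbour of a near vertex
  have hB₃ : ∀ i w, w ≠ v → G.Adj (eB i) w → w = f (eB i) := fun i w hw h =>
    hv.eq_of_adj _ _ _ (hB₁ i).1 hw (hB₂ i).1.ne' h (hB₂ i).2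
  have hB₄ : ∀ i w, w ≠ v → G.Adj (f (eB i)) w → w = eB i := fun i w hw h =>
    hv.eq_of_adj _ _ _ (hB₂ i).1.ne' hw (hB₁ i).1 h (hB₂ i).2.symm
  have hBinj : ∀ i j, f (eB i) = f (eB j) → i = j := fun i j h => by
    have := hB₄ i (eB j) (hB₁ j).1 (h ▸ (hB₂ j).2.symm)
    exact (eB.injective (Subtype.ext this)).symm
  have hBinj' : ∀ i j, (eB i : V) = eB j → i = j := fun i j h => eB.injective (Subtype.ext h)
  have hCinj : ∀ i j, (eC i : V) = eC j → i = j := fun i j h => eC.injective (Subtype.ext h)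
  have hRinj : ∀ i j, (eR i : V) = eR j → i = j := fun i j h => eR.injective (Subtype.ext h)
  have hCmem : ∀ i, (eC i : V) ∈ C := fun i => (eC i).2
  have hCC' : ∀ i w, w ≠ v → w ∉ C → ¬ G.Adj (eC i) w := fun i w hw hwC h =>
    hwC ((hCC _ (hCmem i) w hw h.ne').1 h)
  let φ : JoinOneTwoVert (C.card + 1) a b → V := fun p => match p with
    | .inl i => Fin.cases v (fun j => (eC j : V)) i
    | .inr ⟨.inl i, _⟩ => eR i
    | .inr ⟨.inr i, x⟩ => if x.val = 0 then f (eB i) else eB i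
  have hφ₀ : φ (.inl 0) = v := rfl
  have hφC : ∀ j, φ (.inl (Fin.succ j)) = eC j := fun j => rfl
  have hφR : ∀ i x, φ (.inr ⟨.inl i, x⟩) = eR i := fun i x => rfl
  have hφB : ∀ i x, φ (.inr ⟨.inr i, x⟩) = f (eB i) ∧ x.val = 0 ∨
      φ (.inr ⟨.inr i, x⟩) = eB i ∧ x.val = 1 := fun i x => by
    have hx : x.val < 2 := x.2
    by_cases h : x.val = 0
    · exact Or.inl ⟨if_pos h, h⟩
    · exact Or.inr ⟨if_neg h, by omega⟩
  have hinj : Function.Injective φ := by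
    have hvC : ∀ i, v ≠ eC i := fun i => (hC₁ i).ne
    have hvR : ∀ i, v ≠ eR i := fun i => (hR₁ i).1.ne
    have hvN : ∀ i, v ≠ f (eB i) := fun i => (hB₂ i).1.ne
    have hvB : ∀ i, v ≠ eB i := fun i => (hB₁ i).1.symm
    have hCR : ∀ i j, (eC i : V) ≠ eR j := fun i j h => (hR₁ j).2.1 (h ▸ hCmem i)
    have hCN : ∀ i j, (eC i : V) ≠ f (eB j) := fun i j h => hNC j (h ▸ hCmem i)
    have hCB : ∀ i j, (eC i : V) ≠ eB j := fun i j h => hBC j (h ▸ hCmem i)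
    have hRN : ∀ i j, (eR i : V) ≠ f (eB j) := fun i j h => (hR₁ i).2.2 (h ▸ hN₁ j)
    have hRB : ∀ i j, (eR i : V) ≠ eB j := fun i j h => (hB₁ j).2 (h ▸ (hR₁ i).1)
    have hNB : ∀ i j, f (eB i) ≠ eB j := fun i j h => (hB₁ j).2 (h ▸ (hB₂ i).1)
    rintro (x | ⟨x | x, i⟩) (y | ⟨y | y, j⟩) h
    · congr 1
      induction x using Fin.cases <;> induction y using Fin.cases
      · rfl
      · exact absurd h (hvC _)
      · exact absurd h.symm (hvC _)
      · exact congrArg _ (hCinj _ _ h)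
    · induction x using Fin.cases
      · exact absurd h (hvR _)
      · exact absurd h (hCR _ _)
    · rcases hφB y j with h' | h' <;> rw [h'.1] at h <;> induction x using Fin.cases
      exacts [absurd h (hvN _), absurd h (hCN _ _), absurd h (hvB _), absurd h (hCB _ _)]
    · induction y using Fin.cases
      · exact absurd h.symm (hvR _)
      · exact absurd h.symm (hCR _ _)
    · have hi : i.val < 1 := i.2
      have hj : j.val < 1 := j.2
      rw [Sum.inr.injEq, sigma_fin_ext_iff]
      exact ⟨congrArg _ (hRinj _ _ h), by omega⟩
    · rcases hφB y j with h' | h' <;> rw [h'.1] at h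
      exacts [absurd h (hRN _ _), absurd h (hRB _ _)]
    · rcases hφB x i with h' | h' <;> rw [h'.1] at h <;> induction y using Fin.cases
      exacts [absurd h.symm (hvN _), absurd h.symm (hCN _ _), absurd h.symm (hvB _),
        absurd h.symm (hCB _ _)]
    · rcases hφB x i with h' | h' <;> rw [h'.1] at h
      exacts [absurd h.symm (hRN _ _), absurd h.symm (hRB _ _)]
    · rw [Sum.inr.injEq, sigma_fin_ext_iff]
      rcases hφB x i with h' | h' <;> rcases hφB y j with h'' | h'' <;> rw [h'.1, h''.1] at h
      · exact ⟨congrArg _ (hBinj _ _ h), h'.2.trans h''.2.symm⟩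
      · exact absurd h (hNB _ _)
      · exact absurd h.symm (hNB _ _)
      · exact ⟨congrArg _ (hBinj' _ _ h), h'.2.trans h''.2.symm⟩
  have hbij : Function.Bijective φ :=
    (Fintype.bijective_iff_injective_and_card φ).2 ⟨hinj, by rw [card_joinOneTwoVert, hn]⟩
  refine ⟨RelIso.symm ⟨Equiv.ofBijective φ hbij, ?_⟩⟩
  have hCinr : ∀ x q, G.Adj (φ (.inl x)) (φ (.inr q)) ↔
      (joinOneTwo (C.card + 1) a b).Adj (.inl x) (.inr q) := by
    rintro x ⟨y | y, j⟩
    · have hj : j.val < 1 := j.2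
      induction x using Fin.cases with
      | zero => exact iff_of_true (hR₁ y).1 ⟨rfl, Nat.lt_one_iff.1 hj⟩
      | succ i =>
        exact iff_of_false (hCC' i _ (hR₁ y).1.ne' (hR₁ y).2.1) fun h => Nat.succ_ne_zero _ h.1
    · rcases hφB y j with h' | h' <;> rw [h'.1] <;> induction x using Fin.cases with
      | zero => _
      | succ i => _
      · exact iff_of_true (hB₂ y).1 ⟨rfl, h'.2⟩
      · exact iff_of_false (hCC' i _ (hB₂ y).1.ne' (hNC y)) fun h => Nat.succ_ne_zero _ h.1
      · exact iff_of_false (hB₁ y).2 fun h => one_ne_zero (h'.2.symm.trans h.2)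
      · exact iff_of_false (hCC' i _ (hB₁ y).1 (hBC y)) fun h => Nat.succ_ne_zero _ h.1
  have hRB : ∀ x i y j, G.Adj (φ (.inr ⟨.inl x, i⟩)) (φ (.inr ⟨.inr y, j⟩)) ↔
      (joinOneTwo (C.card + 1) a b).Adj (.inr ⟨.inl x, i⟩) (.inr ⟨.inr y, j⟩) := by
    intro x i y j
    refine iff_of_false (hR₂ x _ ?_) fun h => Sum.inl_ne_inr h.1
    rcases hφB y j with h' | h' <;> rw [h'.1]
    exacts [(hB₂ y).1.ne', (hB₁ y).1]
  intro p q
  rw [Equiv.ofBijective_apply, Equiv.ofBijective_apply]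
  rcases p with x | ⟨x | x, i⟩ <;> rcases q with y | ⟨y | y, j⟩
  · induction x using Fin.cases with
    | zero =>
      induction y using Fin.cases with
      | zero => exact iff_of_false (G.loopless.irrefl _) fun h => h rfl
      | succ j => exact iff_of_true (hC₁ j) (Fin.succ_ne_zero j).symm
    | succ i =>
      induction y using Fin.cases with
      | zero => exact iff_of_true (hC₁ i).symm (Fin.succ_ne_zero i)
      | succ j =>
        have hiff : G.Adj (eC i) (eC j) ↔ i ≠ j :=
          ⟨fun h hij => h.ne (by rw [hij]), fun hij =>
            (hCC _ (hCmem i) _ (hC₁ j).ne' fun h => hij (hCinj _ _ h).symm).2 (hCmem j)⟩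
        exact hiff.trans (Fin.succ_injective _).ne_iff.symm
  · exact hCinr x ⟨.inl y, j⟩
  · exact hCinr x ⟨.inr y, j⟩
  · rw [G.adj_comm, SimpleGraph.adj_comm (joinOneTwo _ _ _)]
    exact hCinr y ⟨.inl x, i⟩
  · have hi : i.val < 1 := i.2
    have hj : j.val < 1 := j.2
    refine iff_of_false (hR₂ x _ (hR₁ y).1.ne') ?_
    rw [cliqueJoin_adj_inr]
    omega
  · exact hRB _ _ _ _
  · rw [G.adj_comm, SimpleGraph.adj_comm (joinOneTwo _ _ _)]
    exact hCinr y ⟨.inr x, i⟩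
  · rw [G.adj_comm, SimpleGraph.adj_comm (joinOneTwo _ _ _)]
    exact hRB _ _ _ _
  · rw [cliqueJoin_adj_inr, Sum.inr.injEq]
    rcases hφB x i with h' | h' <;> rcases hφB y j with h'' | h'' <;>
      rw [h'.1, h''.1, h'.2, h''.2]
    · refine iff_of_false (fun h => ?_) fun h => h.2 rfl
      exact (hB₁ x).2 (hB₄ x _ (hB₂ y).1.ne' h ▸ (hB₂ y).1)
    · constructor
      · intro h
        exact ⟨(hBinj' _ _ (hB₄ x _ (hB₁ y).1 h)).symm, zero_ne_one⟩
      · rintro ⟨rfl, -⟩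
        exact (hB₂ x).2.symm
    · constructor
      · intro h
        exact ⟨hBinj' _ _ (hB₄ y _ (hB₁ x).1 h.symm), one_ne_zero⟩
      · rintro ⟨rfl, -⟩
        exact (hB₂ x).2
    · exact iff_of_false (hv.not_adj_of_far (eB x).2 (eB y).2) fun h => h.2 rfl

end

/-! ### The largest values among graphs with a hub -/

/-- Twice the number of dissociation sets containing the hub, in a graph of order `n` with a hub
and `b` far vertices. -/
def hubTerm (n b : ℕ) : ℕ := 2 ^ b * (2 * n - 3 * b)

theorem hubTerm_lt_hubTerm {n b c : ℕ} (hn : 4 ≤ n) (hbc : b < c) (hc : 2 * c + 1 ≤ n) :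
    hubTerm n b < hubTerm n c := by
  induction c, hbc using Nat.le_induction with
  | base =>
    rw [hubTerm, hubTerm, pow_succ, mul_assoc]
    exact Nat.mul_lt_mul_of_pos_left (by omega) (by positivity)
  | succ c _ ih =>
    refine (ih (by omega)).trans ?_
    rw [hubTerm, hubTerm, pow_succ, mul_assoc]
    exact Nat.mul_lt_mul_of_pos_left (by omega) (by positivity)

theorem two_mul_secondBound {n : ℕ} (hn : 9 ≤ n) :
    2 * secondBound n = 2 ^ n + hubTerm n ((n - 3) / 2) := by
  rw [secondBound, hubTerm]
  have h₁ : 2 * 2 ^ (n - 1) = 2 ^ n := by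
    rw [← pow_succ']
    congr 1
    omega
  rcases Nat.even_or_odd' n with ⟨m, rfl | rfl⟩
  · rw [if_neg (by simp), mul_add, h₁]
    obtain ⟨k, rfl⟩ : ∃ k, m = k + 4 := ⟨m - 4, by omega⟩
    have e₁ : (2 * (k + 4) - 8) / 2 = k := by omega
    have e₂ : (2 * (k + 4) - 3) / 2 = k + 2 := by omega
    have e₃ : 2 * (2 * (k + 4)) - 3 * (k + 2) = k + 10 := by omega
    rw [e₁, e₂, e₃]
    ring
  · rw [if_pos (by simp), mul_add, h₁]
    obtain ⟨k, rfl⟩ : ∃ k, m = k + 3 := ⟨m - 3, by omega⟩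
    have e₁ : (2 * (k + 3) + 1 - 7) / 2 = k := by omega
    have e₂ : (2 * (k + 3) + 1 - 3) / 2 = k + 2 := by omega
    have e₃ : 2 * (2 * (k + 3) + 1) - 3 * (k + 2) = k + 8 := by omega
    rw [e₁, e₂, e₃]
    ring

theorem two_mul_numDissociationSets_joinOneTwo {r a b n : ℕ} (hr : 1 ≤ r) (hr' : r ≤ 3)
    (hn : n = r + a + 2 * b) :
    2 * numDissociationSets (joinOneTwo r a b) = 2 ^ n + hubTerm n b := by
  have h := (joinOneTwo_isHub (a := a) (b := b) hr hr').numDissociationSets_eq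
  rw [card_farVertices_joinOneTwo, card_joinOneTwoVert, ← hn] at h
  rw [hubTerm, Nat.mul_sub]
  have : 2 ^ b * (3 * b) ≤ 2 ^ b * (2 * n) := Nat.mul_le_mul_left _ (by omega)
  rw [← Nat.add_sub_assoc this]
  apply Nat.eq_sub_of_add_eq
  linarith

theorem two_mul_numDissociationSets_graphF {n : ℕ} (hn : 9 ≤ n) :
    2 * numDissociationSets (graphF n) = 2 ^ n + hubTerm n ((n - 1) / 2) := by
  have hb : (if Odd n then (n - 1) / 2 else (n - 2) / 2) = (n - 1) / 2 := by
    split_ifs with h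
    · rfl
    · rw [Nat.not_odd_iff] at h
      omega
  rw [graphF, two_mul_numDissociationSets_joinOneTwo (n := n), hb]
  · split_ifs <;> decide
  · split_ifs <;> decide
  · split_ifs with h <;> rw [Nat.odd_iff] at h <;> omega

theorem numDissociationSets_graphU {n : ℕ} (hn : 9 ≤ n) :
    numDissociationSets (graphU n) = secondBound n := by
  have h := two_mul_numDissociationSets_joinOneTwo (r := 3) (a := (n + 1) % 2) (b := (n - 3) / 2)
    (n := n) (by decide) le_rfl (by omega)
  rw [← two_mul_secondBound hn] at h
  exact Nat.eq_of_mul_eq_mul_left two_pos h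

theorem numDissociationSets_graphT {n : ℕ} (hn : 9 ≤ n) :
    numDissociationSets (graphT n) = secondBound n := by
  have hb : (if Odd n then (n - 3) / 2 else (n - 4) / 2) = (n - 3) / 2 := by
    split_ifs with h
    · rfl
    · rw [Nat.not_odd_iff] at h
      omega
  have h := two_mul_numDissociationSets_joinOneTwo (r := 1) (a := if Odd n then 2 else 3)
    (b := if Odd n then (n - 3) / 2 else (n - 4) / 2) (n := n) le_rfl (by decide)
    (by split_ifs with h <;> rw [Nat.odd_iff] at h <;> omega)
  conv_rhs at h => rw [hb, ← two_mul_secondBound hn]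
  exact Nat.eq_of_mul_eq_mul_left two_pos h

section

variable {V : Type*} [Fintype V] {G : SimpleGraph V} {v : V}

theorem IsHub.card_far_le (hv : IsHub G v) :
    2 * (farVertices G v).card + 1 ≤ Fintype.card V := by
  classical
  have h := hv.card_near_with_far
  have h' := Finset.card_filter_le (nearVertices G v) fun u => ∃ w ∈ farVertices G v, G.Adj u w
  have := card_near_add_card_far (G := G) (v := v)
  omega

theorem IsHub.two_mul_numDissociationSets (hv : IsHub G v) :
    2 * numDissociationSets G =
      2 ^ Fintype.card V + hubTerm (Fintype.card V) (farVertices G v).card := by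
  have h := hv.numDissociationSets_eq
  have h' := hv.card_far_le
  rw [hubTerm, Nat.mul_sub]
  have : 2 ^ (farVertices G v).card * (3 * (farVertices G v).card) ≤
      2 ^ (farVertices G v).card * (2 * Fintype.card V) := Nat.mul_le_mul_left _ (by omega)
  rw [← Nat.add_sub_assoc this]
  apply Nat.eq_sub_of_add_eq
  linarith

open Classical in
/-- The neighbours of the hub that have no far neighbour. -/
noncomputable def coreVertices (G : SimpleGraph V) (v : V) : Finset V :=
  (nearVertices G v).filter fun u => ¬ ∃ w ∈ farVertices G v, G.Adj u w

theorem mem_coreVertices {u : V} :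
    u ∈ coreVertices G v ↔ G.Adj v u ∧ ∀ w ∈ farVertices G v, ¬ G.Adj u w := by
  simp only [coreVertices, Finset.mem_filter, mem_nearVertices]
  push Not
  rfl

theorem IsHub.card_core (hv : IsHub G v) :
    (coreVertices G v).card + 2 * (farVertices G v).card + 1 = Fintype.card V := by
  classical
  have h := hv.card_near_with_far
  have h' := Finset.card_filter_add_card_filter_not (s := nearVertices G v)
    fun u => ∃ w ∈ farVertices G v, G.Adj u w
  have := card_near_add_card_far (G := G) (v := v)
  rw [coreVertices]
  omega

theorem IsHub.mem_core_of_adj (hv : IsHub G v) {u w : V} (hu : u ∈ coreVertices G v) (hw : w ≠ v)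
    (h : G.Adj u w) : w ∈ coreVertices G v := by
  rw [mem_coreVertices] at hu ⊢
  have hvw : G.Adj v w := by
    by_contra hvw
    exact hu.2 w (mem_farVertices.2 ⟨hw, hvw⟩) h
  refine ⟨hvw, fun x hx hwx => ?_⟩
  rw [mem_farVertices] at hx
  exact hx.2 (hv.eq_of_adj w u x hw hu.1.ne' hx.1 h.symm hwx ▸ hu.1)

theorem IsHub.mem_core_of_adj_not_far (hv : IsHub G v) {u w : V} (hu : G.Adj v u)
    (hw : w ∉ farVertices G v) (hwv : w ≠ v) (h : G.Adj u w) : u ∈ coreVertices G v := by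
  rw [mem_coreVertices]
  refine ⟨hu, fun x hx hux => hw ?_⟩
  rwa [hv.eq_of_adj u w x hu.ne' hwv (mem_farVertices.1 hx).1 h hux]

theorem IsHub.nonempty_iso_graphF (hv : IsHub G v) {n : ℕ} (hn : Fintype.card V = n)
    (hb : (farVertices G v).card = (n - 1) / 2) : Nonempty (G ≃g graphF n) := by
  have hcore := hv.card_core
  have hbound := hv.card_far_le
  refine hv.nonempty_iso_joinOneTwo (coreVertices G v) (fun u hu => (mem_coreVertices.1 hu).1)
    ?_ ?_ ?_ ?_ ?_
  · intro u hu w hw hwu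
    refine ⟨hv.mem_core_of_adj hu hw, fun h => absurd ?_ hwu⟩
    exact Finset.card_le_one.1 (by omega) w h u hu
  · intro u hu hvu w hw hwv h
    exact hu (hv.mem_core_of_adj_not_far hvu hw hwv h)
  · split_ifs with h <;> rw [Nat.odd_iff] at h <;> omega
  · split_ifs with h <;> rw [Nat.odd_iff] at h <;> omega
  · split_ifs with h <;> rw [Nat.odd_iff] at h <;> omega

theorem IsHub.nonempty_iso_graphU_or_graphT (hv : IsHub G v) {n : ℕ} (hn : Fintype.card V = n)
    (hn' : 3 ≤ n) (hb : (farVertices G v).card = (n - 3) / 2) :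
    Nonempty (G ≃g graphU n) ∨ Nonempty (G ≃g graphT n) := by
  classical
  have hcore := hv.card_core
  by_cases hxy : ∃ x ∈ coreVertices G v, ∃ y ∈ coreVertices G v, G.Adj x y
  · left
    obtain ⟨x, hx, y, hy, hxy⟩ := hxy
    have hx' := (mem_coreVertices.1 hx).1
    have hy' := (mem_coreVertices.1 hy).1
    have hx₁ : ∀ w, w ≠ v → G.Adj x w → w = y := fun w hw h =>
      hv.eq_of_adj x w y hx'.ne' hw hy'.ne' h hxy
    have hy₁ : ∀ w, w ≠ v → G.Adj y w → w = x := fun w hw h =>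
      hv.eq_of_adj y w x hy'.ne' hw hx'.ne' h hxy.symm
    refine hv.nonempty_iso_joinOneTwo {x, y} ?_ ?_ ?_ ?_ ?_ ?_
    · intro u hu
      rw [Finset.mem_insert, Finset.mem_singleton] at hu
      rcases hu with rfl | rfl <;> assumption
    · intro u hu w hw hwu
      rw [Finset.mem_insert, Finset.mem_singleton] at hu ⊢
      rcases hu with rfl | rfl
      · exact ⟨fun h => Or.inr (hx₁ w hw h), fun h => (h.resolve_left hwu) ▸ hxy⟩
      · exact ⟨fun h => Or.inl (hy₁ w hw h), fun h => (h.resolve_right hwu) ▸ hxy.symm⟩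
    · intro u hu hvu w hw hwv h
      rw [Finset.mem_insert, Finset.mem_singleton, not_or] at hu
      have huR := hv.mem_core_of_adj_not_far hvu hw hwv h
      have hwR := hv.mem_core_of_adj huR hwv h
      have hwx : w ≠ x := by
        rintro rfl
        exact hu.2 (hx₁ u hvu.ne' h.symm)
      have hwy : w ≠ y := by
        rintro rfl
        exact hu.1 (hy₁ u hvu.ne' h.symm)
      -- the core has at most three vertices, but two disjoint edges would need four
      have hsub : ({x, y, u, w} : Finset V) ⊆ coreVertices G v := by
        intro z hz
        simp only [Finset.mem_insert, Finset.mem_singleton] at hz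
        rcases hz with rfl | rfl | rfl | rfl <;> assumption
      have := Finset.card_le_card hsub
      rw [Finset.card_insert_of_notMem, Finset.card_insert_of_notMem, Finset.card_pair h.ne] at this
      · omega
      · simp [Ne.symm hu.2, hwy.symm]
      · simp [hxy.ne, Ne.symm hu.1, hwx.symm]
    · rw [Finset.card_pair hxy.ne]
    · rw [hb]
    · omega
  · right
    push Not at hxy
    refine hv.nonempty_iso_joinOneTwo ∅ (by simp) (by simp) ?_ (by simp) ?_ ?_
    · intro u _ hvu w hw hwv h
      have huR := hv.mem_core_of_adj_not_far hvu hw hwv h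
      exact hxy u huR w (hv.mem_core_of_adj huR hwv h) h
    · split_ifs with h <;> rw [Nat.odd_iff] at h <;> omega
    · split_ifs with h <;> rw [Nat.odd_iff] at h <;> omega

/-- Among graphs with a hub, `b = (n - 1) / 2` far vertices occur only in `F_n`, the next smaller
number only in `U_n` and `T_n`, and fewer far vertices give fewer dissociation sets. -/
theorem IsHub.second_largest (hv : IsHub G v) {n : ℕ} (hn : 9 ≤ n) (hV : Fintype.card V = n)
    (hF : ¬ Nonempty (G ≃g graphF n)) :
    numDissociationSets G < secondBound n ∨
      numDissociationSets G = secondBound n ∧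
        (Nonempty (G ≃g graphU n) ∨ Nonempty (G ≃g graphT n)) := by
  have h₁ := hv.two_mul_numDissociationSets
  have h₂ := two_mul_secondBound hn
  have h₃ := hv.card_far_le
  rw [hV] at h₁ h₃
  have h₄ : (farVertices G v).card ≠ (n - 1) / 2 := fun h => hF (hv.nonempty_iso_graphF hV h)
  rcases lt_or_eq_of_le (show (farVertices G v).card ≤ (n - 3) / 2 by omega) with h | h
  · left
    have := hubTerm_lt_hubTerm (n := n) (by omega) h (by omega)
    omega
  · right
    rw [h] at h₁
    exact ⟨by omega, hv.nonempty_iso_graphU_or_graphT hV (by omega) h⟩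

end

/-! ### Counting dissociation sets of embedded trees -/

/-- `IsTreeEmbedding G p f`: the injective map `i ↦ f i`, `i ≤ p.length`, embeds into `G` the tree
encoded by `p`. Vertex `0` is the root, and the list `p` holds the parents of the other vertices
`1, …, p.length`, the parent of the last vertex at its head. -/
def IsTreeEmbedding {V : Type*} (G : SimpleGraph V) : List ℕ → (ℕ → V) → Prop
  | [], _ => True
  | c :: p, f => IsTreeEmbedding G p f ∧ c ≤ p.length ∧ G.Adj (f c) (f (p.length + 1)) ∧
      ∀ i ≤ p.length, f i ≠ f (p.length + 1)

/-- The state of a vertex of a graph with respect to a dissociation set: outside of it, in it and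
without neighbours in it, in it and with a neighbour in it. -/
inductive VertexState
  | out
  | single
  | paired

/-- The dissociation sets of the tree encoded by a parent list, as functions that give the state of
each vertex. -/
def treeStates : List ℕ → List (ℕ → VertexState)
  | [] => [fun _ => .out, fun _ => .single]
  | c :: p => (treeStates p).flatMap fun σ =>
      match σ c with
      | .out => [Function.update σ (p.length + 1) .out, Function.update σ (p.length + 1) .single]
      | .single => [Function.update σ (p.length + 1) .out,
          Function.update (Function.update σ c .paired) (p.length + 1) .paired]
      | .paired => [Function.update σ (p.length + 1) .out]

/-- The weight of a vertex in a given state. In the elimination of leaves, `A`, `B` and `C` count the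
ways to continue a set to the removed descendants of the vertex: with the vertex not in the set,
with the vertex but none of its removed children in the set, and with the vertex and one of its
removed children in the set. -/
def stateWeight (A B C : ℕ) : VertexState → ℕ
  | .out => A
  | .single => B + C
  | .paired => B

/-- `f` with the value at `c` replaced by `x`; a form of `Function.update` that evaluates well. -/
def natUpdate (f : ℕ → ℕ) (c x i : ℕ) : ℕ := bif Nat.beq i c then x else f i

theorem natUpdate_self (f : ℕ → ℕ) (c x : ℕ) : natUpdate f c x c = x := by
  simp [natUpdate]

theorem natUpdate_of_ne (f : ℕ → ℕ) {c i : ℕ} (x : ℕ) (h : i ≠ c) : natUpdate f c x i = f i := by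
  rw [natUpdate, Bool.eq_false_iff.2 fun h' => h (Nat.eq_of_beq_eq_true h'), cond_false]

/-- The weighted number of dissociation sets of the tree encoded by a parent list, computed by
merging the last vertex, which is a leaf, into its parent. -/
def treeSum : List ℕ → (ℕ → ℕ) → (ℕ → ℕ) → (ℕ → ℕ) → ℕ
  | [], A, B, C => A 0 + B 0 + C 0
  | c :: p, A, B, C =>
    treeSum p
      (natUpdate A c (A c * (A (p.length + 1) + B (p.length + 1) + C (p.length + 1))))
      (natUpdate B c (B c * A (p.length + 1)))
      (natUpdate C c (C c * A (p.length + 1) + B c * B (p.length + 1)))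

/-- The number of dissociation sets of the tree encoded by a parent list. -/
def treeCount (p : List ℕ) : ℕ := treeSum p (fun _ => 1) (fun _ => 1) (fun _ => 0)

section

variable {V : Type*} {G : SimpleGraph V}

theorem treeSum_eq_sum {p : List ℕ} {f : ℕ → V} (hp : IsTreeEmbedding G p f) (A B C : ℕ → ℕ) :
    treeSum p A B C = ((treeStates p).map fun σ =>
      ∏ i ∈ Finset.range (p.length + 1), stateWeight (A i) (B i) (C i) (σ i)).sum := by
  induction p generalizing A B C with
  | nil => simp [treeSum, treeStates, stateWeight, add_assoc]
  | cons c p ih =>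
    obtain ⟨hp, hc, -⟩ := hp
    have hck : c ∈ Finset.range (p.length + 1) := Finset.mem_range.2 (by omega)
    rw [treeSum, ih hp, treeStates, List.map_flatMap, List.flatMap_def, List.sum_flatten,
      List.map_map]
    congr 1
    refine List.map_congr_left fun σ _ => ?_
    have hk : ∀ τ : ℕ → VertexState,
        ∏ i ∈ Finset.range ((c :: p).length + 1), stateWeight (A i) (B i) (C i) (τ i) =
          stateWeight (A c) (B c) (C c) (τ c) *
            (∏ i ∈ (Finset.range (p.length + 1)).erase c, stateWeight (A i) (B i) (C i) (τ i)) *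
            stateWeight (A (p.length + 1)) (B (p.length + 1)) (C (p.length + 1))
              (τ (p.length + 1)) := fun τ => by
      rw [List.length_cons, Finset.prod_range_succ,
        Finset.mul_prod_erase _ (fun i => stateWeight (A i) (B i) (C i) (τ i)) hck]
    -- on the vertices other than `c` and the leaf, all states in question agree with `σ`
    have hτ : ∀ τ : ℕ → VertexState, (∀ i, i ≠ c → i ≠ p.length + 1 → τ i = σ i) →
        ∏ i ∈ (Finset.range (p.length + 1)).erase c, stateWeight (A i) (B i) (C i) (τ i) =
        ∏ i ∈ (Finset.range (p.length + 1)).erase c, stateWeight (A i) (B i) (C i) (σ i) := by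
      intro τ h
      refine Finset.prod_congr rfl fun i hi => ?_
      rw [Finset.mem_erase, Finset.mem_range] at hi
      rw [h i hi.1 (by omega)]
    have hleft : ∏ i ∈ (Finset.range (p.length + 1)).erase c,
        stateWeight
          (natUpdate A c (A c * (A (p.length + 1) + B (p.length + 1) + C (p.length + 1))) i)
          (natUpdate B c (B c * A (p.length + 1)) i)
          (natUpdate C c (C c * A (p.length + 1) + B c * B (p.length + 1)) i) (σ i) =
        ∏ i ∈ (Finset.range (p.length + 1)).erase c, stateWeight (A i) (B i) (C i) (σ i) := by
      refine Finset.prod_congr rfl fun i hi => ?_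
      rw [Finset.mem_erase] at hi
      simp only [natUpdate_of_ne _ _ hi.1]
    have hne : c ≠ p.length + 1 := by omega
    rw [← Finset.mul_prod_erase _ _ hck, hleft]
    simp only [natUpdate_self, Function.comp_apply]
    cases hσ : σ c with
    | out =>
      simp only [List.map_cons, List.map_nil, List.sum_cons, List.sum_nil, hk]
      rw [hτ (Function.update σ (p.length + 1) .out) fun i _ h => Function.update_of_ne h _ _,
        hτ (Function.update σ (p.length + 1) .single) fun i _ h => Function.update_of_ne h _ _]
      simp only [Function.update_self, Function.update_of_ne hne, hσ, stateWeight]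
      ring
    | single =>
      simp only [List.map_cons, List.map_nil, List.sum_cons, List.sum_nil, hk]
      rw [hτ (Function.update σ (p.length + 1) .out) fun i _ h => Function.update_of_ne h _ _,
        hτ (Function.update (Function.update σ c .paired) (p.length + 1) .paired)
          fun i h' h => by rw [Function.update_of_ne h, Function.update_of_ne h']]
      simp only [Function.update_self, Function.update_of_ne hne, hσ, stateWeight]
      ring
    | paired =>
      simp only [List.map_cons, List.map_nil, List.sum_cons, List.sum_nil, hk]
      rw [hτ (Function.update σ (p.length + 1) .out) fun i _ h => Function.update_of_ne h _ _]
      simp only [Function.update_self, Function.update_of_ne hne, hσ, stateWeight]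
      ring

theorem treeCount_eq_length {p : List ℕ} {f : ℕ → V} (hp : IsTreeEmbedding G p f) :
    treeCount p = (treeStates p).length := by
  have h : ∀ s, stateWeight 1 1 0 s = 1 := by rintro (_ | _ | _) <;> rfl
  rw [treeCount, treeSum_eq_sum hp]
  simp [h]

theorem IsTreeEmbedding.injOn {p : List ℕ} {f : ℕ → V} (hp : IsTreeEmbedding G p f) :
    Set.InjOn f (Finset.range (p.length + 1)) := by
  induction p with
  | nil =>
    intro i hi j hj _
    simp at hi hj
    omega
  | cons c p ih =>
    obtain ⟨hp, -, -, h⟩ := hp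
    intro i hi j hj hij
    simp only [List.length_cons, Finset.coe_range, Set.mem_Iio] at hi hj
    rcases (show i ≤ p.length ∨ i = p.length + 1 by omega) with hi | rfl <;>
      rcases (show j ≤ p.length ∨ j = p.length + 1 by omega) with hj | rfl
    · exact ih hp (by simp; omega) (by simp; omega) hij
    · exact absurd hij (h i hi)
    · exact absurd hij.symm (h j hj)
    · rfl

/-- Each dissociation set of `G` traces out one of the dissociation sets of an embedded tree. -/
theorem IsTreeEmbedding.exists_state [Fintype V] {p : List ℕ} {f : ℕ → V}
    (hp : IsTreeEmbedding G p f) {S : Finset V} (hS : S ∈ dissociationFinset G) :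
    ∃ σ ∈ treeStates p, (∀ i ≤ p.length, σ i = .out ↔ f i ∉ S) ∧
      ∀ i ≤ p.length, σ i = .paired → ∃ j ≤ p.length, f j ∈ S ∧ G.Adj (f i) (f j) := by
  induction p with
  | nil =>
    by_cases h : f 0 ∈ S
    · exact ⟨fun _ => .single, by simp [treeStates], by simp [h], by simp⟩
    · exact ⟨fun _ => .out, by simp [treeStates], by simp [h], by simp⟩
  | cons c p ih =>
    obtain ⟨hp, hc, hadj, hnew⟩ := hp
    obtain ⟨σ, hσ, h₁, h₂⟩ := ih hp
    have hne : c ≠ p.length + 1 := by omega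
    have hsplit : ∀ i ≤ p.length + 1, i = p.length + 1 ∨ i ≠ p.length + 1 ∧ i ≤ p.length := by
      omega
    simp only [treeStates, List.mem_flatMap, List.length_cons]
    by_cases hk : f (p.length + 1) ∈ S
    · cases hσc : σ c with
      | out =>
        refine ⟨Function.update σ (p.length + 1) .single, ⟨σ, hσ, by simp [hσc]⟩, ?_, ?_⟩
        · intro i hi
          rcases hsplit i hi with rfl | ⟨h, hi⟩
          · simp [hk]
          · rw [Function.update_of_ne h, h₁ i hi]
        · intro i hi hi'
          rcases hsplit i hi with rfl | ⟨h, hi⟩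
          · simp at hi'
          · rw [Function.update_of_ne h] at hi'
            obtain ⟨j, hj, hj'⟩ := h₂ i hi hi'
            exact ⟨j, by omega, hj'⟩
      | single =>
        have hcS : f c ∈ S := by
          by_contra h
          rw [(h₁ c hc).2 h] at hσc
          cases hσc
        refine ⟨Function.update (Function.update σ c .paired) (p.length + 1) .paired,
          ⟨σ, hσ, by simp [hσc]⟩, ?_, ?_⟩
        · intro i hi
          rcases hsplit i hi with rfl | ⟨h, hi⟩
          · simp [hk]
          · rw [Function.update_of_ne h]
            by_cases hic : i = c
            · subst hic
              simp [hcS]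
            · rw [Function.update_of_ne hic, h₁ i hi]
        · intro i hi hi'
          rcases hsplit i hi with rfl | ⟨h, hi⟩
          · exact ⟨c, by omega, hcS, hadj.symm⟩
          · by_cases hic : i = c
            · subst hic
              exact ⟨p.length + 1, le_rfl, hk, hadj⟩
            · rw [Function.update_of_ne h, Function.update_of_ne hic] at hi'
              obtain ⟨j, hj, hj'⟩ := h₂ i hi hi'
              exact ⟨j, by omega, hj'⟩
      | paired =>
        -- the parent would have two neighbours in the set
        have hcS : f c ∈ S := by
          by_contra h
          rw [(h₁ c hc).2 h] at hσc
          cases hσc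
        obtain ⟨j, hj, hjS, hcj⟩ := h₂ c hc hσc
        exact absurd (mem_dissociationFinset.1 hS _ hcS _ hjS _ hk hcj hadj) (hnew j hj)
    · refine ⟨Function.update σ (p.length + 1) .out, ⟨σ, hσ, ?_⟩, ?_, ?_⟩
      · cases σ c <;> simp
      · intro i hi
        rcases hsplit i hi with rfl | ⟨h, hi⟩
        · simp [hk]
        · rw [Function.update_of_ne h, h₁ i hi]
      · intro i hi hi'
        rcases hsplit i hi with rfl | ⟨h, hi⟩
        · simp at hi'
        · rw [Function.update_of_ne h] at hi'
          obtain ⟨j, hj, hj'⟩ := h₂ i hi hi'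
          exact ⟨j, by omega, hj'⟩

theorem IsTreeEmbedding.length_lt_card [Fintype V] {p : List ℕ} {f : ℕ → V}
    (hp : IsTreeEmbedding G p f) : p.length + 1 ≤ Fintype.card V := by
  classical
  have := Finset.card_image_of_injOn hp.injOn
  rw [Finset.card_range] at this
  rw [← this]
  exact Finset.card_le_univ _

/-- A random subset of `V` is a dissociation set at most as often as its trace on an embedded
tree is. -/
theorem IsTreeEmbedding.numDissociationSets_le [Fintype V] {p : List ℕ} {f : ℕ → V}
    (hp : IsTreeEmbedding G p f) :
    numDissociationSets G ≤ treeCount p * 2 ^ (Fintype.card V - (p.length + 1)) := by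
  classical
  set I := (Finset.range (p.length + 1)).image f with hI
  have hIcard : I.card = p.length + 1 := by
    rw [hI, Finset.card_image_of_injOn hp.injOn, Finset.card_range]
  set P : Finset (Finset V) := ((treeStates p).map fun σ =>
    ((Finset.range (p.length + 1)).filter fun i => σ i ≠ .out).image f).toFinset with hP
  have hPcard : P.card ≤ treeCount p := by
    rw [treeCount_eq_length hp, hP]
    exact (List.toFinset_card_le _).trans_eq (List.length_map _)
  rw [numDissociationSets_eq_card]
  calc (dissociationFinset G).card ≤ (P ×ˢ Iᶜ.powerset).card := by
        refine Finset.card_le_card_of_injOn (fun S => (S ∩ I, S \ I)) ?_ ?_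
        · intro S hS
          rw [Finset.mem_coe, Finset.mem_product, Finset.mem_powerset]
          constructor
          · obtain ⟨σ, hσ, h, -⟩ := hp.exists_state hS
            rw [hP, List.mem_toFinset, List.mem_map]
            refine ⟨σ, hσ, ?_⟩
            ext x
            rw [Finset.mem_image, Finset.mem_inter, hI, Finset.mem_image]
            constructor
            · rintro ⟨i, hi, rfl⟩
              rw [Finset.mem_filter, Finset.mem_range] at hi
              refine ⟨?_, i, Finset.mem_range.2 hi.1, rfl⟩
              by_contra hx
              exact hi.2 ((h i (by omega)).2 hx)
            · rintro ⟨hx, i, hi, rfl⟩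
              have hi' := Finset.mem_range.1 hi
              exact ⟨i, Finset.mem_filter.2 ⟨hi, fun h' => (h i (by omega)).1 h' hx⟩, rfl⟩
          · intro x hx
            exact Finset.mem_compl.2 (Finset.mem_sdiff.1 hx).2
        · intro S _ T _ h
          rw [Prod.mk.injEq] at h
          rw [← Finset.sdiff_union_inter S I, h.1, h.2, Finset.sdiff_union_inter]
    _ = P.card * 2 ^ (Fintype.card V - (p.length + 1)) := by
        rw [Finset.card_product, Finset.card_powerset, Finset.card_compl, hIcard]
    _ ≤ _ := Nat.mul_le_mul_right _ hPcard

end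

/-! ### The search through embedded trees -/

/-- The test made on the order `k` and the number `d` of dissociation sets of a spanning tree of the
graph. Orders up to eight do not occur, `secondBound 9 = 292` and `secondBound 10 = 556`. -/
def spanningCheck (k d : ℕ) : Bool :=
  Nat.ble k 8 || (Nat.beq k 9 && Nat.ble d 291) || (Nat.beq k 10 && Nat.ble d 555)

/-- The search through the trees that contain the tree encoded by `p`, where no further children of
the vertices below `c` are allowed: either vertex `c` gets a new child or it is closed. A branch ends
when at most half of the vertex sets of the tree are dissociation sets. The first argument bounds
the depth. -/
def treeSearch : ℕ → List ℕ → ℕ → Bool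
  | 0, _, _ => false
  | n + 1, p, c =>
    bif Nat.ble c p.length then
      (Nat.ble (treeCount (c :: p)) (2 ^ (p.length + 1)) || treeSearch n (c :: p) c) &&
        treeSearch n p (c + 1)
    else spanningCheck (p.length + 1) (treeCount p)

section

variable {V : Type*} {G : SimpleGraph V}

theorem SimpleGraph.Connected.forall_mem_of_adj_closed (hG : G.Connected) {s : Set V}
    (hs : ∀ x ∈ s, ∀ y, G.Adj x y → y ∈ s) {x : V} (hx : x ∈ s) (y : V) : y ∈ s := by
  obtain ⟨w⟩ := hG.preconnected x y
  induction w with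
  | nil => exact hx
  | cons h _ ih => exact ih (hs _ hx _ h)

theorem IsTreeEmbedding.congr {p : List ℕ} {f g : ℕ → V} (hp : IsTreeEmbedding G p f)
    (h : ∀ i ≤ p.length, g i = f i) : IsTreeEmbedding G p g := by
  induction p with
  | nil => trivial
  | cons c p ih =>
    obtain ⟨hp, hc, hadj, hne⟩ := hp
    rw [List.length_cons] at h
    refine ⟨ih hp fun i hi => h i (by omega), hc, ?_, fun i hi => ?_⟩
    · rwa [h c (by omega), h _ le_rfl]
    · rw [h i (by omega), h _ le_rfl]
      exact hne i hi

/-- Attach a further vertex of `G` to an embedded tree. -/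
theorem IsTreeEmbedding.cons {p : List ℕ} {f : ℕ → V} (hp : IsTreeEmbedding G p f) {c : ℕ}
    (hc : c ≤ p.length) {w : V} (hw : G.Adj (f c) w) (hw' : ∀ i ≤ p.length, f i ≠ w) :
    IsTreeEmbedding G (c :: p) (Function.update f (p.length + 1) w) := by
  refine ⟨hp.congr fun i hi => Function.update_of_ne (by omega) _ _, hc, ?_, fun i hi => ?_⟩
  · rwa [Function.update_self, Function.update_of_ne (by omega)]
  · rw [Function.update_self, Function.update_of_ne (by omega)]
    exact hw' i hi

theorem two_pow_lt_secondBound {n : ℕ} : 2 ^ (n - 1) < secondBound n := by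
  rw [secondBound]
  split_ifs
  all_goals exact Nat.lt_add_of_pos_right (by positivity)

variable [Fintype V]

theorem IsTreeEmbedding.lt_secondBound_of_treeCount_le {p : List ℕ} {f : ℕ → V}
    (hp : IsTreeEmbedding G p f) (h : treeCount p ≤ 2 ^ p.length) :
    numDissociationSets G < secondBound (Fintype.card V) := by
  refine (hp.numDissociationSets_le.trans ?_).trans_lt two_pow_lt_secondBound
  refine (Nat.mul_le_mul_right _ h).trans_eq ?_
  have := hp.length_lt_card
  rw [← pow_add]
  congr 1
  omega

theorem lt_secondBound_of_treeSearch (hG : G.Connected) (hV : 9 ≤ Fintype.card V) {n : ℕ}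
    {p : List ℕ} {c : ℕ} (hsearch : treeSearch n p c = true) {f : ℕ → V}
    (hp : IsTreeEmbedding G p f)
    (hclosed : ∀ i < c, ∀ w, G.Adj (f i) w → ∃ j ≤ p.length, f j = w) :
    numDissociationSets G < secondBound (Fintype.card V) := by
  induction n generalizing p c f with
  | zero => cases hsearch
  | succ n ih =>
    rw [treeSearch] at hsearch
    by_cases hc : c ≤ p.length
    · rw [Nat.ble_eq_true_of_le hc, cond_true, Bool.and_eq_true, Bool.or_eq_true] at hsearch
      by_cases hw : ∀ w, G.Adj (f c) w → ∃ j ≤ p.length, f j = w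
      · refine ih hsearch.2 hp fun i hi => ?_
        rcases Nat.lt_succ_iff_lt_or_eq.1 hi with hi | rfl
        · exact hclosed i hi
        · exact hw
      · push Not at hw
        obtain ⟨w, hcw, hw⟩ := hw
        have hp' := hp.cons hc hcw hw
        rcases hsearch.1 with h | h
        · exact hp'.lt_secondBound_of_treeCount_le (Nat.le_of_ble_eq_true h)
        · refine ih h hp' fun i hi x hx => ?_
          rw [Function.update_of_ne (by omega)] at hx
          obtain ⟨j, hj, rfl⟩ := hclosed i hi x hx
          exact ⟨j, hj.trans (Nat.le_succ _), Function.update_of_ne (by omega) _ _⟩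
    · -- all vertices are closed, so the tree is a spanning tree
      have hc' : Nat.ble c p.length = false := Bool.eq_false_iff.2 fun h =>
        hc (Nat.le_of_ble_eq_true h)
      rw [hc', cond_false] at hsearch
      have hall : ∀ x, x ∈ {x | ∃ j ≤ p.length, f j = x} := fun x => by
        refine hG.forall_mem_of_adj_closed (s := {x | ∃ j ≤ p.length, f j = x}) ?_ (x := f 0)
          ⟨0, Nat.zero_le _, rfl⟩ x
        rintro _ ⟨j, hj, rfl⟩ y hy
        exact hclosed j (by omega) y hy
      have hcard : Fintype.card V = p.length + 1 := by
        classical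
        refine le_antisymm ?_ hp.length_lt_card
        rw [← Finset.card_univ, ← Finset.card_range (p.length + 1)]
        refine Finset.card_le_card_of_surjOn f ?_
        intro x _
        obtain ⟨j, hj, rfl⟩ := hall x
        exact ⟨j, Finset.mem_coe.2 (Finset.mem_range.2 (by omega)), rfl⟩
      have hle := hp.numDissociationSets_le
      rw [hcard, Nat.sub_self, pow_zero, mul_one] at hle
      rw [hcard] at hV
      rw [spanningCheck, Bool.or_eq_true, Bool.or_eq_true, Bool.and_eq_true, Bool.and_eq_true]
        at hsearch
      rcases hsearch with (h | ⟨h, h'⟩) | ⟨h, h'⟩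
      · have := Nat.le_of_ble_eq_true h
        omega
      · rw [hcard, Nat.eq_of_beq_eq_true h]
        exact hle.trans_lt ((Nat.le_of_ble_eq_true h').trans_lt (by decide))
      · rw [hcard, Nat.eq_of_beq_eq_true h]
        exact hle.trans_lt ((Nat.le_of_ble_eq_true h').trans_lt (by decide))

end

/-- The search from the path of order six. -/
theorem treeSearch_path : treeSearch 30 [4, 3, 2, 1, 0] 0 = true := by decide +kernel

/-- The search from two paths on three vertices, the centre of one joined to an end of the other. -/
theorem treeSearch_center_end : treeSearch 30 [4, 3, 0, 0, 0] 0 = true := by decide +kernel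

/-- The search from two paths on three vertices whose centres are joined. -/
theorem treeSearch_center_center : treeSearch 30 [3, 3, 0, 0, 0] 0 = true := by decide +kernel

/-! ### Two disjoint paths on three vertices -/

/-- `a - b - c` is a path on three vertices in `G`, not necessarily induced. -/
structure IsCherry {V : Type*} (G : SimpleGraph V) (a b c : V) : Prop where
  left : G.Adj b a
  right : G.Adj b c
  ne : a ≠ c

/-- The triples `(a, b, c)` and `(d, e, f)` have no common vertex. -/
def DisjointTriples {V : Type*} (a b c d e f : V) : Prop :=
  Disjoint ({a, b, c} : Set V) {d, e, f}

theorem disjointTriples_iff {V : Type*} {a b c d e f : V} : DisjointTriples a b c d e f ↔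
    (a ≠ d ∧ a ≠ e ∧ a ≠ f) ∧ (b ≠ d ∧ b ≠ e ∧ b ≠ f) ∧ (c ≠ d ∧ c ≠ e ∧ c ≠ f) := by
  simp [DisjointTriples, eq_comm]
  tauto

section

variable {V : Type*} {G : SimpleGraph V}

theorem IsCherry.symm {a b c : V} (h : IsCherry G a b c) : IsCherry G c b a :=
  ⟨h.right, h.left, h.ne.symm⟩

theorem DisjointTriples.symm {a b c d e f : V} (h : DisjointTriples a b c d e f) :
    DisjointTriples d e f a b c :=
  Disjoint.symm h

/-- Along a walk between two disjoint paths on three vertices, the first of them can be moved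
towards the second until they are joined by an edge. -/
theorem exists_adj_cherries {x y : V} (w : G.Walk x y) {a b c d e f : V} (h₁ : IsCherry G a b c)
    (h₂ : IsCherry G d e f) (h : DisjointTriples a b c d e f) (hx : x = a ∨ x = b ∨ x = c)
    (hy : y = d ∨ y = e ∨ y = f) :
    ∃ a b c d e f x y, IsCherry G a b c ∧ IsCherry G d e f ∧ DisjointTriples a b c d e f ∧
      (x = a ∨ x = b ∨ x = c) ∧ (y = d ∨ y = e ∨ y = f) ∧ G.Adj x y := by
  induction w generalizing a b c with
  | nil =>
    rw [disjointTriples_iff] at h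
    grind
  | @cons x z y hxz w ih =>
    by_cases hz : z = d ∨ z = e ∨ z = f
    · exact ⟨a, b, c, d, e, f, x, z, h₁, h₂, h, hx, hz, hxz⟩
    · by_cases hz' : z = a ∨ z = b ∨ z = c
      · exact ih h₁ h hz' hy
      · obtain ⟨x', hxx', hx'⟩ : ∃ x', G.Adj x x' ∧ (x' = a ∨ x' = b ∨ x' = c) := by
          rcases hx with rfl | rfl | rfl
          exacts [⟨b, h₁.left.symm, by simp⟩, ⟨a, h₁.left, by simp⟩, ⟨b, h₁.right.symm, by simp⟩]
        refine ih (a := z) (b := x) (c := x') ⟨hxz, hxx', ?_⟩ ?_ (by simp) hy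
        · rintro rfl
          exact hz' hx'
        · rw [disjointTriples_iff] at *
          grind

/-- A vertex of a path on three vertices is its centre or one of its ends. -/
theorem IsCherry.center_or_end {a b c x : V} (h : IsCherry G a b c)
    (hx : x = a ∨ x = b ∨ x = c) :
    x = b ∨ ∃ c', IsCherry G x b c' ∧ ({x, b, c'} : Set V) = {a, b, c} := by
  rcases hx with rfl | rfl | rfl
  · exact Or.inr ⟨c, h, rfl⟩
  · exact Or.inl rfl
  · refine Or.inr ⟨a, h.symm, ?_⟩
    ext
    simp only [Set.mem_insert_iff, Set.mem_singleton_iff]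
    tauto

theorem DisjointTriples.congr {a b c d e f a' b' c' d' e' f' : V}
    (h : DisjointTriples a b c d e f) (h₁ : ({a', b', c'} : Set V) = {a, b, c})
    (h₂ : ({d', e', f'} : Set V) = {d, e, f}) : DisjointTriples a' b' c' d' e' f' := by
  rwa [DisjointTriples, h₁, h₂]

/-- The sequence `a, b, c, d, e, f`, continued by `f`. -/
def sixVertices {V : Type*} (a b c d e f : V) : ℕ → V
  | 0 => a
  | 1 => b
  | 2 => c
  | 3 => d
  | 4 => e
  | _ => f

theorem isTreeEmbedding_path {a b c d e f : V} (h₁ : IsCherry G a b c) (h₂ : IsCherry G d e f)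
    (h : DisjointTriples a b c d e f) (hadj : G.Adj a d) :
    IsTreeEmbedding G [4, 3, 2, 1, 0] (sixVertices c b a d e f) := by
  have := h₁.left.ne
  have := h₁.right.ne
  have := h₁.ne
  have := h₂.left.ne
  have := h₂.right.ne
  have := h₂.ne
  rw [disjointTriples_iff] at h
  refine ⟨⟨⟨⟨⟨trivial, ?_, h₁.right.symm, ?_⟩, ?_, h₁.left, ?_⟩, ?_, hadj, ?_⟩, ?_,
    h₂.left.symm, ?_⟩, ?_, h₂.right, ?_⟩ <;> try decide
  all_goals
    intro i hi
    simp only [List.length_cons, List.length_nil] at hi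
    interval_cases i <;> simp only [sixVertices, List.length_cons, List.length_nil] <;> grind

theorem isTreeEmbedding_center_end {a b c d e f : V} (h₁ : IsCherry G a b c)
    (h₂ : IsCherry G d e f) (h : DisjointTriples a b c d e f) (hadj : G.Adj b d) :
    IsTreeEmbedding G [4, 3, 0, 0, 0] (sixVertices b a c d e f) := by
  have := h₁.left.ne
  have := h₁.right.ne
  have := h₁.ne
  have := h₂.left.ne
  have := h₂.right.ne
  have := h₂.ne
  rw [disjointTriples_iff] at h
  refine ⟨⟨⟨⟨⟨trivial, ?_, h₁.left, ?_⟩, ?_, h₁.right, ?_⟩, ?_, hadj, ?_⟩, ?_,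
    h₂.left.symm, ?_⟩, ?_, h₂.right, ?_⟩ <;> try decide
  all_goals
    intro i hi
    simp only [List.length_cons, List.length_nil] at hi
    interval_cases i <;> simp only [sixVertices, List.length_cons, List.length_nil] <;> grind

theorem isTreeEmbedding_center_center {a b c d e f : V} (h₁ : IsCherry G a b c)
    (h₂ : IsCherry G d e f) (h : DisjointTriples a b c d e f) (hadj : G.Adj b e) :
    IsTreeEmbedding G [3, 3, 0, 0, 0] (sixVertices b a c e d f) := by
  have := h₁.left.ne
  have := h₁.right.ne
  have := h₁.ne
  have := h₂.left.ne
  have := h₂.right.ne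
  have := h₂.ne
  rw [disjointTriples_iff] at h
  refine ⟨⟨⟨⟨⟨trivial, ?_, h₁.left, ?_⟩, ?_, h₁.right, ?_⟩, ?_, hadj, ?_⟩, ?_,
    h₂.left, ?_⟩, ?_, h₂.right, ?_⟩ <;> try decide
  all_goals
    intro i hi
    simp only [List.length_cons, List.length_nil] at hi
    interval_cases i <;> simp only [sixVertices, List.length_cons, List.length_nil] <;> grind

/-- Two disjoint paths on three vertices force few dissociation sets. -/
theorem lt_secondBound_of_disjoint_cherries [Fintype V] (hG : G.Connected)
    (hV : 9 ≤ Fintype.card V) {a b c d e f : V} (h₁ : IsCherry G a b c) (h₂ : IsCherry G d e f)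
    (h : DisjointTriples a b c d e f) :
    numDissociationSets G < secondBound (Fintype.card V) := by
  obtain ⟨w⟩ := hG.preconnected a d
  obtain ⟨a, b, c, d, e, f, x, y, h₁, h₂, h, hx, hy, hadj⟩ :=
    exists_adj_cherries w h₁ h₂ h (by simp) (by simp)
  rcases h₁.center_or_end hx with rfl | ⟨c', h₁', hc⟩ <;>
    rcases h₂.center_or_end hy with rfl | ⟨f', h₂', hf⟩
  · exact lt_secondBound_of_treeSearch hG hV treeSearch_center_center
      (isTreeEmbedding_center_center h₁ h₂ h hadj) (by simp)
  · exact lt_secondBound_of_treeSearch hG hV treeSearch_center_end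
      (isTreeEmbedding_center_end h₁ h₂' (h.congr rfl hf) hadj) (by simp)
  · exact lt_secondBound_of_treeSearch hG hV treeSearch_center_end
      (isTreeEmbedding_center_end h₂ h₁' (h.symm.congr rfl hc) hadj.symm) (by simp)
  · exact lt_secondBound_of_treeSearch hG hV treeSearch_path
      (isTreeEmbedding_path h₁' h₂' (h.congr hc hf) hadj) (by simp)

end

/-! ### The existence of a hub -/

section

variable {V : Type*} [Fintype V] {G : SimpleGraph V} {v : V}

/-- If `v` has three neighbours and there are no two disjoint paths on three vertices, every vertex
is within distance two of `v`. -/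
theorem exists_near_of_no_disjoint_cherries (hG : G.Connected)
    (hno : ∀ a b c d e f, IsCherry G a b c → IsCherry G d e f → ¬ DisjointTriples a b c d e f)
    (hv : 3 ≤ (nearVertices G v).card) {w : V} (hw : w ≠ v) (hvw : ¬ G.Adj v w) :
    ∃ u, G.Adj v u ∧ G.Adj w u := by
  classical
  have key : w ∈ {x | x = v ∨ G.Adj v x ∨ ∃ u, G.Adj v u ∧ G.Adj x u} := by
    refine hG.forall_mem_of_adj_closed ?_ (x := v) (Or.inl rfl) w
    rintro x hx y hxy
    by_contra hy
    simp only [Set.mem_ofPred_eq, not_or, not_exists, not_and] at hx hy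
    obtain ⟨hyv, hvy, hy⟩ := hy
    rcases hx with rfl | hx | ⟨u, hvu, hxu⟩
    · exact hvy hxy
    · exact hy x hx hxy.symm
    · have hvx : ¬ G.Adj v x := fun h => hy x h hxy.symm
      have hxv : x ≠ v := by
        rintro rfl
        exact hvy hxy
      -- `v` with two further neighbours, and `u, x, y`
      have hcard := Finset.pred_card_le_card_erase (s := nearVertices G v) (a := u)
      obtain ⟨p, hp, q, hq, hpq⟩ := Finset.one_lt_card.1
        (show 1 < ((nearVertices G v).erase u).card by omega)
      rw [Finset.mem_erase, mem_nearVertices] at hp hq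
      refine hno p v q u x y ⟨hp.2, hq.2, hpq⟩ ⟨hxu, hxy, ?_⟩ ?_
      · rintro rfl
        exact hvy hvu
      · have := hvu.ne
        rw [disjointTriples_iff]
        grind
  simp only [Set.mem_ofPred_eq] at key
  tauto

/-- A vertex of maximum degree at least three in a connected graph of order at least nine without
two disjoint paths on three vertices is a hub. -/
theorem isHub_of_no_disjoint_cherries (hG : G.Connected) (hV : 9 ≤ Fintype.card V)
    (hno : ∀ a b c d e f, IsCherry G a b c → IsCherry G d e f → ¬ DisjointTriples a b c d e f)
    (hv : 3 ≤ (nearVertices G v).card) : IsHub G v := by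
  classical
  refine ⟨?_, fun w hw hvw => exists_near_of_no_disjoint_cherries hG hno hv hw hvw⟩
  have hnear : ∀ w, w ≠ v → ¬ G.Adj v w → ∃ u, G.Adj v u ∧ G.Adj w u :=
    fun w hw hvw => exists_near_of_no_disjoint_cherries hG hno hv hw hvw
  choose! g hg using hnear
  have hgfar : ∀ w ∈ farVertices G v, G.Adj v (g w) ∧ G.Adj w (g w) := fun w hw =>
    hg w (mem_farVertices.1 hw).1 (mem_farVertices.1 hw).2
  -- a near vertex has at most one far neighbour, so there are at most as many far as near vertices
  have hinj : Set.InjOn g (farVertices G v) := by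
    intro s hs t ht hst
    by_contra hne
    have hs' := hgfar s hs
    have ht' := hgfar t ht
    rw [← hst] at ht'
    have hcard := Finset.pred_card_le_card_erase (s := nearVertices G v) (a := g s)
    obtain ⟨p, hp, q, hq, hpq⟩ := Finset.one_lt_card.1
      (show 1 < ((nearVertices G v).erase (g s)).card by omega)
    rw [Finset.mem_erase, mem_nearVertices] at hp hq
    rw [Finset.mem_coe, mem_farVertices] at hs ht
    refine hno p v q s (g s) t ⟨hp.2, hq.2, hpq⟩ ⟨hs'.2.symm, ht'.2.symm, hne⟩ ?_
    have := hs'.1.ne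
    rw [disjointTriples_iff]
    grind
  have himage : (farVertices G v).image g ⊆ nearVertices G v := by
    intro u hu
    obtain ⟨w, hw, rfl⟩ := Finset.mem_image.1 hu
    exact mem_nearVertices.2 (hgfar w hw).1
  have hle := Finset.card_le_card himage
  rw [Finset.card_image_of_injOn hinj] at hle
  have hcard := card_near_add_card_far (G := G) (v := v)
  intro x y z hx hy hz hxy hxz
  by_contra hyz
  have hcherry : IsCherry G y x z := ⟨hxy, hxz, hyz⟩
  by_cases h₁ : 1 < (nearVertices G v \ {y, x, z}).card
  · obtain ⟨p, hp, q, hq, hpq⟩ := Finset.one_lt_card.1 h₁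
    simp only [Finset.mem_sdiff, mem_nearVertices, Finset.mem_insert, Finset.mem_singleton]
      at hp hq
    refine hno y x z p v q hcherry ⟨hp.1, hq.1, hpq⟩ ?_
    rw [disjointTriples_iff]
    grind
  · -- now `v` has degree four, three of its neighbours are `x`, `y` and `z`, and each of its
    -- neighbours has a far neighbour
    have h₂ := Finset.card_le_three (a := y) (b := x) (c := z)
    have h₃ := Finset.card_sdiff_add_card_inter (nearVertices G v) {y, x, z}
    have h₄ := Finset.card_le_card
      (Finset.inter_subset_right : nearVertices G v ∩ {y, x, z} ⊆ {y, x, z})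
    have h₅ : nearVertices G v ∩ {y, x, z} = {y, x, z} :=
      Finset.eq_of_subset_of_card_le Finset.inter_subset_right (by omega)
    have h₆ : (farVertices G v).image g = nearVertices G v :=
      Finset.eq_of_subset_of_card_le himage (by
        rw [Finset.card_image_of_injOn hinj]
        omega)
    obtain ⟨u, hu⟩ := Finset.card_pos.1 (show 0 < (nearVertices G v \ {y, x, z}).card by omega)
    simp only [Finset.mem_sdiff, Finset.mem_insert, Finset.mem_singleton] at hu
    obtain ⟨w, hw, rfl⟩ := Finset.mem_image.1 (h₆.symm ▸ hu.1)
    have h₇ : ∀ t, t = y ∨ t = x ∨ t = z → G.Adj v t := by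
      intro t ht
      have : t ∈ nearVertices G v ∩ {y, x, z} := by
        rw [h₅]
        simpa using ht
      exact mem_nearVertices.1 (Finset.mem_inter.1 this).1
    have hw' := mem_farVertices.1 hw
    have h₈ := h₇ x (by simp)
    have h₉ := h₇ y (by simp)
    have h₁₀ := h₇ z (by simp)
    refine hno y x z w (g w) v hcherry
      ⟨(hgfar w hw).2.symm, (hgfar w hw).1.symm, hw'.1⟩ ?_
    rw [disjointTriples_iff]
    grind

/-- In a connected graph of maximum degree at most two without two disjoint paths on three vertices,
the neighbours `a` and `c` of `b`, their neighbours, and the neighbours of these are all vertices. -/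
theorem card_le_seven_of_no_disjoint_cherries (hG : G.Connected)
    (hno : ∀ a b c d e f, IsCherry G a b c → IsCherry G d e f → ¬ DisjointTriples a b c d e f)
    (hdeg : ∀ x, (nearVertices G x).card ≤ 2) {a b c : V} (h : IsCherry G a b c) :
    Fintype.card V ≤ 7 := by
  classical
  have hb : ∀ x, G.Adj b x → x = a ∨ x = c := by
    intro x hx
    by_contra hne
    push Not at hne
    have hsub : ({x, a, c} : Finset V) ⊆ nearVertices G b := by
      intro y hy
      simp only [Finset.mem_insert, Finset.mem_singleton] at hy
      rw [mem_nearVertices]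
      rcases hy with rfl | rfl | rfl
      exacts [hx, h.left, h.right]
    have := (Finset.card_le_card hsub).trans (hdeg b)
    rw [Finset.card_eq_three.2 ⟨x, a, c, hne.1, hne.2, h.ne, rfl⟩] at this
    omega
  set A := (nearVertices G a).erase b with hA
  set C := (nearVertices G c).erase b with hC
  have herase : ∀ x y, G.Adj x y → ((nearVertices G x).erase y).card ≤ 1 := by
    intro x y hxy
    rw [Finset.card_erase_of_mem (mem_nearVertices.2 hxy)]
    have := hdeg x
    omega
  have hAcard : A.card ≤ 1 := herase a b h.left.symm
  have hCcard : C.card ≤ 1 := herase c b h.right.symm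
  have hmemA : ∀ x, x ∈ A ↔ x ≠ b ∧ G.Adj a x := fun x => by simp [hA]
  have hmemC : ∀ x, x ∈ C ↔ x ≠ b ∧ G.Adj c x := fun x => by simp [hC]
  set A' := A.biUnion fun x => (nearVertices G x).erase a with hA'
  set C' := C.biUnion fun x => (nearVertices G x).erase c with hC'
  have hA'card : A'.card ≤ 1 := by
    refine (Finset.card_biUnion_le_card_mul _ _ 1 fun x hx => ?_).trans (by omega)
    exact herase x a ((hmemA x).1 hx).2.symm
  have hC'card : C'.card ≤ 1 := by
    refine (Finset.card_biUnion_le_card_mul _ _ 1 fun x hx => ?_).trans (by omega)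
    exact herase x c ((hmemC x).1 hx).2.symm
  have hmemA' : ∀ x, x ∈ A' ↔ ∃ y ∈ A, x ≠ a ∧ G.Adj y x := fun x => by simp [hA']
  have hmemC' : ∀ x, x ∈ C' ↔ ∃ y ∈ C, x ≠ c ∧ G.Adj y x := fun x => by simp [hC']
  have hall : ∀ x, x ∈ (({a, b, c} ∪ (A ∪ C) ∪ (A' ∪ C') : Finset V) : Set V) := by
    refine hG.forall_mem_of_adj_closed ?_ (x := b) (by simp)
    intro x hx y hxy
    by_contra hy
    simp only [Finset.coe_union, Finset.coe_insert, Finset.coe_singleton, Set.mem_union,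
      Set.mem_insert_iff, Set.mem_singleton_iff, Finset.mem_coe, not_or] at hx hy
    obtain ⟨⟨⟨hya, hyb, hyc⟩, hyA, hyC⟩, hyA', hyC'⟩ := hy
    have hay : ¬ G.Adj a y := fun h => hyA ((hmemA y).2 ⟨hyb, h⟩)
    have hcy : ¬ G.Adj c y := fun h => hyC ((hmemC y).2 ⟨hyb, h⟩)
    have hxA : x ∉ A := fun h => hyA' ((hmemA' y).2 ⟨x, h, hya, hxy⟩)
    have hxC : x ∉ C := fun h => hyC' ((hmemC' y).2 ⟨x, h, hyc, hxy⟩)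
    have hxa : x ≠ a := by
      rintro rfl
      exact hay hxy
    have hxc : x ≠ c := by
      rintro rfl
      exact hcy hxy
    have hxb : x ≠ b := by
      rintro rfl
      rcases hb y hxy with h | h
      exacts [hya h, hyc h]
    have hax : ¬ G.Adj a x := fun h => hxA ((hmemA x).2 ⟨hxb, h⟩)
    have hcx : ¬ G.Adj c x := fun h => hxC ((hmemC x).2 ⟨hxb, h⟩)
    -- so `x` has a neighbour `z` among the neighbours of `a` and `c`, and `z, x, y` is a path
    obtain ⟨z, hz, hzb, hzx⟩ : ∃ z, (G.Adj a z ∨ G.Adj c z) ∧ z ≠ b ∧ G.Adj z x := by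
      rcases hx with ((hx | hx | hx) | hx | hx) | hx | hx
      · exact absurd hx hxa
      · exact absurd hx hxb
      · exact absurd hx hxc
      · exact absurd hx hxA
      · exact absurd hx hxC
      · obtain ⟨z, hz, -, hzx⟩ := (hmemA' x).1 hx
        obtain ⟨hzb, haz⟩ := (hmemA z).1 hz
        exact ⟨z, Or.inl haz, hzb, hzx⟩
      · obtain ⟨z, hz, -, hzx⟩ := (hmemC' x).1 hx
        obtain ⟨hzb, hcz⟩ := (hmemC z).1 hz
        exact ⟨z, Or.inr hcz, hzb, hzx⟩
    refine hno a b c z x y h ⟨hzx.symm, hxy, ?_⟩ ?_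
    · rintro rfl
      exact hz.elim hay hcy
    · have hza : z ≠ a := by
        rintro rfl
        exact hax hzx
      have hzc : z ≠ c := by
        rintro rfl
        exact hcx hzx
      rw [disjointTriples_iff]
      grind
  have hcard : Fintype.card V ≤ ({a, b, c} ∪ (A ∪ C) ∪ (A' ∪ C') : Finset V).card := by
    rw [← Finset.card_univ]
    exact Finset.card_le_card fun x _ => Finset.mem_coe.1 (hall x)
  have h₁ := Finset.card_union_le ({a, b, c} ∪ (A ∪ C)) (A' ∪ C')
  have h₂ := Finset.card_union_le {a, b, c} (A ∪ C)
  have h₃ := Finset.card_union_le A C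
  have h₄ := Finset.card_union_le A' C'
  have h₅ := Finset.card_le_three (a := a) (b := b) (c := c)
  omega

/-- A connected graph of order at least nine has a hub or two disjoint paths on three vertices. -/
theorem exists_isHub_of_no_disjoint_cherries (hG : G.Connected) (hV : 9 ≤ Fintype.card V)
    (hno : ∀ a b c d e f, IsCherry G a b c → IsCherry G d e f → ¬ DisjointTriples a b c d e f) :
    ∃ v, IsHub G v := by
  classical
  by_cases h₃ : ∃ v, 3 ≤ (nearVertices G v).card
  · obtain ⟨v, hv⟩ := h₃
    exact ⟨v, isHub_of_no_disjoint_cherries hG hV hno hv⟩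
  exfalso
  push Not at h₃
  by_cases h₂ : ∃ a b c, IsCherry G a b c
  · obtain ⟨a, b, c, h⟩ := h₂
    have := card_le_seven_of_no_disjoint_cherries hG hno (fun x => Nat.lt_succ_iff.1 (h₃ x)) h
    omega
  · obtain ⟨v⟩ := hG.nonempty
    have hall : ∀ x, x ∈ ((insert v (nearVertices G v) : Finset V) : Set V) := by
      refine hG.forall_mem_of_adj_closed ?_ (x := v) (by simp)
      intro x hx y hxy
      rw [Finset.mem_coe, Finset.mem_insert, mem_nearVertices] at hx ⊢
      rcases hx with rfl | hx
      · exact Or.inr hxy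
      · left
        by_contra hne
        exact h₂ ⟨v, x, y, hx.symm, hxy, Ne.symm hne⟩
    have hcard := Finset.card_le_card
      (fun x _ => Finset.mem_coe.1 (hall x) : Finset.univ ⊆ insert v (nearVertices G v))
    have := Finset.card_insert_le v (nearVertices G v)
    have := h₃ v
    rw [Finset.card_univ] at hcard
    omega

end

theorem theorem3p3 (n : ℕ) (hn : 9 ≤ n) :
    secondBound n < numDissociationSets (graphF n) ∧
    ∀ {V : Type*} [Fintype V] (G : SimpleGraph V), Fintype.card V = n → G.Connected →
      ¬ Nonempty (G ≃g graphF n) →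
        numDissociationSets G ≤ secondBound n ∧
        (numDissociationSets G = secondBound n ↔
          Nonempty (G ≃g graphU n) ∨ Nonempty (G ≃g graphT n)) := by
  refine ⟨?_, ?_⟩
  · have h₁ := two_mul_numDissociationSets_graphF hn
    have h₂ := two_mul_secondBound hn
    have h₃ := hubTerm_lt_hubTerm (n := n) (b := (n - 3) / 2) (c := (n - 1) / 2) (by omega)
      (by omega) (by omega)
    omega
  · intro V _ G hV hG hF
    have key : numDissociationSets G < secondBound n ∨
        numDissociationSets G = secondBound n ∧
          (Nonempty (G ≃g graphU n) ∨ Nonempty (G ≃g graphT n)) := by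
      by_cases hno : ∀ a b c d e f, IsCherry G a b c → IsCherry G d e f →
          ¬ DisjointTriples a b c d e f
      · obtain ⟨v, hv⟩ := exists_isHub_of_no_disjoint_cherries hG (by omega) hno
        exact hv.second_largest hn hV hF
      · push Not at hno
        obtain ⟨a, b, c, d, e, f, h₁, h₂, h⟩ := hno
        rw [← hV]
        exact Or.inl (lt_secondBound_of_disjoint_cherries hG (by omega) h₁ h₂ h)
    refine ⟨key.elim le_of_lt fun h => h.1.le, fun h => ?_, ?_⟩
    · exact (key.resolve_left h.not_lt).2
    · rintro (⟨⟨e⟩⟩ | ⟨⟨e⟩⟩)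
      · rw [numDissociationSets_congr e, numDissociationSets_graphU hn]
      · rw [numDissociationSets_congr e, numDissociationSets_graphT hn]
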